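/- Let $N\ge 1$ be an integer, $\sigma\in(0,2)$, $m_c=(N-\sigma)_+/N$, and $0<m<m_c$. Let $J:\mathbb{R}^N\times\mathbb{R}^N\to\mathbb{R}$ be a measurable kernel such that, for some $\Lambda>0$, $J(x,y)=J(y,x)$ and $\frac{1}{\Lambda|x-y|^{N+\sigma}}\le J(x,y)\le \frac{\Lambda}{|x-y|^{N+\sigma}}$ for all $x\neq y$, and $J(x,x+z)=J(x,x-z)$ for all $x$ and all $z\ne0$. Let $\varphi\in C([0,\infty))\cap C^1((0,\infty))$ be strictly increasing with $\varphi(0)=0$ and $\varphi^{1+A}$ concave for some $A>0$, and suppose that, for some $c>0$, $\varphi'(s)\ge c\,s^{m-1}$ for all $s>0$. Write $\mathcal{E}(f,g)=\frac12\iint (f(x)-f(y))(g(x)-g(y))J(x,y)\,dx\,dy$, and let $\dot H^{\sigma/2}(\mathbb{R}^N)$ be the space of all $f\in L^{2N/(N-\sigma)}(\mathbb{R}^N)$ with $\iint \frac{(f(x)-f(y))^2}{|x-y|^{N+\sigma}}\,dx\,dy<\infty$ (note that $N>\sigma$, since $m_c>0$). Let $u_0\in L^1(\mathbb{R}^N)\cap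 L^\infty(\mathbb{R}^N)$, and let $u\ge 0$ be a nonnegative weak solution of $\partial_t u+\mathcal{L}\varphi(u)=0$ in $Q=\mathbb{R}^N\times(0,\infty)$, $u(\cdot,0)=u_0$, where $\mathcal{L}f(x)=\mathrm{P.V.}\int_{\mathbb{R}^N}(f(x)-f(y))J(x,y)\,dy$; that is, $u\in C([0,\infty):L^1(\mathbb{R}^N))$, $\varphi(u)\in L^2_{\mathrm{loc}}((0,\infty):\dot H^{\sigma/2}(\mathbb{R}^N))$, $u(\cdot,0)=u_0$ almost everywhere, and $$\int_0^\infty\int_{\mathbb{R}^N}u\,\partial_t\zeta\,dx\,dt-\int_0^\infty\mathcal{E}(\varphi(u(t)),\zeta(t))\,dt=0\qquad\text{for every }\zeta\in C_c^\infty(Q).$$ Then there is a time $T>0$ such that, for every $t\ge T$, $u(x,t)=0$ for almost every $x\in\mathbb{R}^N$. -/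

import Mathlib

open MeasureTheory Set Filter Topology
open scoped ENNReal ContDiff

namespace FastDiffusion

/-- A measurable stable-like kernel of order `σ` on `ℝ^N`: symmetric, even in the increment, and
comparable to `|x - y|^{-(N+σ)}` off the diagonal. Measurability is in the sense of Lebesgue. -/
structure IsStableLikeKernel {N : ℕ} (σ : ℝ)
    (J : EuclideanSpace ℝ (Fin N) → EuclideanSpace ℝ (Fin N) → ℝ) : Prop where
  measurable : AEMeasurable (Function.uncurry J) (volume.prod volume)
  symm : ∀ x y, x ≠ y → J x y = J y x
  even : ∀ x z, z ≠ 0 → J x (x + z) = J x (x - z)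
  bounds : ∃ Λ : ℝ, 0 < Λ ∧ ∀ x y, x ≠ y →
    1 / (Λ * ‖x - y‖ ^ ((N : ℝ) + σ)) ≤ J x y ∧ J x y ≤ Λ / ‖x - y‖ ^ ((N : ℝ) + σ)

/-- The standing assumptions on the nonlinearity `φ : [0,∞) → ℝ` (the values of `φ` at negative
numbers play no role). -/
structure IsFastDiffusionNonlinearity (φ : ℝ → ℝ) : Prop where
  continuousOn : ContinuousOn φ (Ici 0)
  contDiffOn : ContDiffOn ℝ 1 φ (Ioi 0)
  map_zero : φ 0 = 0
  strictMonoOn : StrictMonoOn φ (Ici 0)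
  concave_rpow : ∃ A : ℝ, 0 < A ∧ ConcaveOn ℝ (Ici 0) (fun s => φ s ^ (1 + A))

/-- The critical exponent `m_c = (N - σ)_+ / N`. -/
noncomputable def criticalExponent (N : ℕ) (σ : ℝ) : ℝ := max ((N : ℝ) - σ) 0 / N

/-- The nonlocal interaction energy
`E(f,g) = 1/2 ∬ (f(x) - f(y)) (g(x) - g(y)) J(x,y) dx dy`. -/
noncomputable def energy {N : ℕ}
    (J : EuclideanSpace ℝ (Fin N) → EuclideanSpace ℝ (Fin N) → ℝ)
    (f g : EuclideanSpace ℝ (Fin N) → ℝ) : ℝ :=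
  (1 / 2) * ∫ p : EuclideanSpace ℝ (Fin N) × EuclideanSpace ℝ (Fin N),
    (f p.1 - f p.2) * (g p.1 - g p.2) * J p.1 p.2 ∂(volume.prod volume)

/-- The square of the homogeneous fractional Sobolev (Gagliardo) seminorm of order `σ/2`,
with values in `[0,∞]`. -/
noncomputable def gagliardoSq {N : ℕ} (σ : ℝ) (f : EuclideanSpace ℝ (Fin N) → ℝ) : ℝ≥0∞ :=
  ∫⁻ p : EuclideanSpace ℝ (Fin N) × EuclideanSpace ℝ (Fin N),
    ENNReal.ofReal ((f p.1 - f p.2) ^ 2 / ‖p.1 - p.2‖ ^ ((N : ℝ) + σ)) ∂(volume.prod volume)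

/-- `f` belongs to the homogeneous fractional Sobolev space of order `σ/2`: its Gagliardo seminorm
is finite and, if `N > σ`, it is the representative that lies in `L^{2N/(N-σ)}` (for `N ≤ σ`
elements are functions modulo constants, and no normalization is imposed). -/
structure MemHomogeneousSobolev {N : ℕ} (σ : ℝ) (f : EuclideanSpace ℝ (Fin N) → ℝ) : Prop where
  aestronglyMeasurable : AEStronglyMeasurable f volume
  gagliardoSq_lt_top : gagliardoSq σ f < ⊤
  memLp : σ < N → MemLp f (ENNReal.ofReal (2 * N / (N - σ))) volume

/-- `u`, written `u t x`, is a weak solution of `∂_t u + L φ(u) = 0` in `Q = ℝ^N × (0,∞)` with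
`u(·,0) = u₀`, where `L` is the operator with kernel `J`. -/
structure IsWeakSolution {N : ℕ} (σ : ℝ)
    (J : EuclideanSpace ℝ (Fin N) → EuclideanSpace ℝ (Fin N) → ℝ) (φ : ℝ → ℝ)
    (u₀ : EuclideanSpace ℝ (Fin N) → ℝ) (u : ℝ → EuclideanSpace ℝ (Fin N) → ℝ) : Prop where
  /-- `u` is a measurable function on `(0,∞) × ℝ^N`. -/
  aestronglyMeasurable :
    AEStronglyMeasurable (Function.uncurry u) ((volume.restrict (Ioi (0 : ℝ))).prod volume)
  /-- `u` is a continuous curve `[0,∞) → L¹(ℝ^N)`. -/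
  memLp_one : ∀ t, 0 ≤ t → MemLp (u t) 1 volume
  continuous_L1 : ∀ t, 0 ≤ t →
    Tendsto (fun s => eLpNorm (u s - u t) 1 volume) (𝓝[Ici 0] t) (𝓝 0)
  /-- `φ(u) ∈ L²_loc((0,∞) : H)`, `H` the homogeneous fractional Sobolev space of order `σ/2`. -/
  memSobolev : ∀ᵐ t ∂(volume.restrict (Ioi (0 : ℝ))), MemHomogeneousSobolev σ (fun x => φ (u t x))
  locallySqIntegrable : ∀ a b : ℝ, 0 < a → a < b →
    ∫⁻ t in Icc a b, gagliardoSq σ (fun x => φ (u t x)) < ⊤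
  /-- The equation, tested against every `ζ ∈ C_c^∞(Q)`. -/
  equation : ∀ ζ : EuclideanSpace ℝ (Fin N) × ℝ → ℝ, ContDiff ℝ ∞ ζ → HasCompactSupport ζ →
    tsupport ζ ⊆ univ ×ˢ Ioi (0 : ℝ) →
    (∫ t in Ioi (0 : ℝ), ∫ x, u t x * deriv (fun s => ζ (x, s)) t)
      - ∫ t in Ioi (0 : ℝ), energy J (fun x => φ (u t x)) (fun x => ζ (x, t)) = 0
  /-- The initial datum is taken almost everywhere. -/
  initial : u 0 =ᵐ[volume] u₀

end FastDiffusion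

/-! Put `p = q + 1 = N(1 - m)/σ`; the condition `m < m_c` says exactly that `p > 1`. Let `V(t) = ∫
u(t)^p`, which is finite at time `0` because the datum is integrable and bounded. Formally, testing
the equation with `u^q` gives `V' = -p E(φ(u), u^q)`, and the point is to bound this energy below by
a multiple of `V^(1 - σ/N)`. As this exponent is less than one, `V` reaches zero in finite time.

The lower bound (`exists_mul_lintegral_le_dissipation`) needs no Sobolev embedding. If `V ≤ λ`,
Chebyshev bounds the measure of `{u > u(x)/2}`, so in a ball around `x` of twice that measure at
least half of the points have `u(y) ≤ u(x)/2`. This gives kernel mass at least `C λ^(-σ/N)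
u(x)^(pσ/N)` there, and for such `y` the integrand is at least a multiple of `u(x)^m u(x)^q` times
the kernel. Since `pσ/N = 1 - m`, the powers add up to `u(x)^p`, and the dissipation is at least `C
λ^(-σ/N) V`. As `V` is nonincreasing, it halves in a time proportional to `λ^(σ/N)`, and these times
form a convergent geometric series (`exists_forall_eq_zero_of_halving`).

The rest justifies the energy computation. The power `u^q` is truncated to `θ(u)`, which is bounded,
vanishes for small `u` and is Lipschitz in `φ(u)`; thus it is integrable and has finite seminorm.
The weak formulation is extended to such functions of `x` by cutoff and mollification
(`integral_sub_mul_eq`). No time derivative of `u` is available, so the equation is integrated over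
`(t - h, t)` against `θ(u(t))` frozen at the final time. Convexity of the primitive `Θ` of `θ` gives
`Θ(u(t)) - Θ(u(t-h)) ≤ (u(t) - u(t-h)) θ(u(t))`, and replacing `φ(u(r))` by `φ(u(t))` costs an error
that is `o(h)` after integration in `t`, by continuity of translations in `L²`. This is
`entropy_add_dissipation_le`; Fatou then removes the truncation. -/

namespace FastDiffusion

/-! ### Translations in `L²`, the Lévy condition, and distributional derivatives in time -/

/-- Composition with a continuous family of measure preserving maps is continuous in `L²`. -/
theorem tendsto_lintegral_comp_sub_sq {Z X : Type*} [TopologicalSpace Z] [TopologicalSpace X]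
    [MeasurableSpace X] [BorelSpace X] [R1Space X] {ν : Measure X} [ν.InnerRegularCompactLTTop]
    [IsLocallyFiniteMeasure ν] (T : Z → X → X) (hT : Continuous (Function.uncurry T))
    (hTm : ∀ z, MeasurePreserving (T z) ν ν) (z₀ : Z) (hz₀ : ∀ x, T z₀ x = x)
    {f : X → ℝ} (hf : MemLp f 2 ν) :
    Tendsto (fun z => ∫⁻ x, ENNReal.ofReal ((f (T z x) - f x) ^ 2) ∂ν) (𝓝 z₀) (𝓝 0) := by
  let G : C(Z, C(X, X)) := (ContinuousMap.mk _ hT).curry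
  have hc : Continuous fun z => Lp.compMeasurePreserving (G z) (hTm z) (hf.toLp f) :=
    continuous_const.compMeasurePreservingLp G.continuous _ (by simp)
  have h1 := (hc.tendsto z₀)
  rw [tendsto_iff_edist_tendsto_0] at h1
  have h2 := ENNReal.Tendsto.pow (n := 2) h1
  rw [zero_pow two_ne_zero] at h2
  refine h2.congr fun z => ?_
  rw [Lp.edist_def, eLpNorm_eq_lintegral_rpow_enorm_toReal (by simp) (by simp), ← ENNReal.rpow_natCast,
    ← ENNReal.rpow_mul]
  simp only [ENNReal.toReal_ofNat, Nat.cast_ofNat, one_div, ne_eq, OfNat.ofNat_ne_zero,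
    not_false_eq_true, inv_mul_cancel₀, ENNReal.rpow_one]
  refine lintegral_congr_ae ?_
  have e1 : Lp.compMeasurePreserving (G z) (hTm z) (hf.toLp f) =ᵐ[ν] f ∘ T z := by
    refine (Lp.coeFn_compMeasurePreserving _ _).trans ?_
    exact (hTm z).quasiMeasurePreserving.ae_eq_comp hf.coeFn_toLp
  have e2 : Lp.compMeasurePreserving (G z₀) (hTm z₀) (hf.toLp f) =ᵐ[ν] f := by
    refine (Lp.coeFn_compMeasurePreserving _ _).trans ?_
    refine ((hTm z₀).quasiMeasurePreserving.ae_eq_comp hf.coeFn_toLp).trans ?_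
    exact Eventually.of_forall fun x => by simp [hz₀]
  filter_upwards [e1, e2] with x h1 h2
  rw [Pi.sub_apply, h1, h2, Function.comp, Real.enorm_eq_ofReal_abs, ENNReal.rpow_ofNat,
    ← ENNReal.ofReal_pow (abs_nonneg _), sq_abs]

/-- The Lévy integrability condition for stable-like kernels. -/
theorem lintegral_min_one_sq_mul_rpow_lt_top {E : Type*} [NormedAddCommGroup E] [NormedSpace ℝ E]
    [FiniteDimensional ℝ E] [MeasurableSpace E] [BorelSpace E] [Nontrivial E]
    (μ : Measure E) [μ.IsAddHaarMeasure] {σ : ℝ} (hσ : σ ∈ Ioo (0 : ℝ) 2) :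
    ∫⁻ z, ENNReal.ofReal (min 1 ‖z‖ ^ 2 * ‖z‖ ^ (-((Module.finrank ℝ E : ℝ) + σ))) ∂μ < ⊤ := by
  set d := Module.finrank ℝ E with hd
  have hdpos : 0 < d := Module.finrank_pos
  have key : IntegrableOn (fun y : ℝ => y ^ (d - 1) •
      (min 1 y ^ 2 * y ^ (-((d : ℝ) + σ)))) (Ioi 0) := by
    rw [← Ioc_union_Ioi_eq_Ioi zero_le_one]
    refine IntegrableOn.union ?_ ?_
    · have h : IntegrableOn (fun y : ℝ => y ^ (1 - σ)) (Ioc 0 1) :=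
        (intervalIntegrable_iff_integrableOn_Ioc_of_le zero_le_one).1
          (intervalIntegral.intervalIntegrable_rpow' (by linarith [hσ.2]))
      refine h.congr_fun (fun y hy => ?_) measurableSet_Ioc
      have hy0 : 0 < y := hy.1
      simp only [min_eq_right hy.2, smul_eq_mul]
      rw [← Real.rpow_natCast, ← Real.rpow_natCast, ← Real.rpow_add hy0, ← Real.rpow_add hy0]
      congr 1
      push_cast [Nat.cast_sub (Nat.one_le_iff_ne_zero.2 hdpos.ne')]
      ring
    · have h : IntegrableOn (fun y : ℝ => y ^ (-1 - σ)) (Ioi 1) :=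
        integrableOn_Ioi_rpow_of_lt (by linarith [hσ.1]) zero_lt_one
      refine h.congr_fun (fun y hy => ?_) measurableSet_Ioi
      have hy0 : 0 < y := zero_lt_one.trans hy
      simp only [min_eq_left (mem_Ioi.1 hy).le, smul_eq_mul, one_pow, one_mul]
      rw [← Real.rpow_natCast, ← Real.rpow_add hy0]
      congr 1
      push_cast [Nat.cast_sub (Nat.one_le_iff_ne_zero.2 hdpos.ne')]
      ring
  have := (integrable_fun_norm_addHaar μ
    (f := fun y : ℝ => min 1 y ^ 2 * y ^ (-((d : ℝ) + σ)))).2 key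
  exact this.lintegral_lt_top

theorem deriv_smoothTransition_eq_zero {y : ℝ} (hy : y ∉ Icc (0 : ℝ) 1) :
    deriv Real.smoothTransition y = 0 := by
  rw [mem_Icc, not_and_or, not_le, not_le] at hy
  rcases hy with h | h
  · have : Real.smoothTransition =ᶠ[𝓝 y] fun _ => 0 := by
      filter_upwards [Iio_mem_nhds h] with z hz using Real.smoothTransition.zero_of_nonpos hz.le
    rw [this.deriv_eq, deriv_const]
  · have : Real.smoothTransition =ᶠ[𝓝 y] fun _ => 1 := by
      filter_upwards [Ioi_mem_nhds h] with z hz using Real.smoothTransition.one_of_one_le hz.le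
    rw [this.deriv_eq, deriv_const]

theorem continuous_deriv_smoothTransition : Continuous (deriv Real.smoothTransition) :=
  (Real.smoothTransition.contDiff (n := 1)).continuous_deriv le_rfl

theorem integral_deriv_smoothTransition : ∫ y, deriv Real.smoothTransition y = 1 := by
  have h1 : ∫ y, deriv Real.smoothTransition y = ∫ y in Ioc (0:ℝ) 1, deriv Real.smoothTransition y := by
    rw [← integral_Icc_eq_integral_Ioc]
    exact (setIntegral_eq_integral_of_forall_compl_eq_zero fun y hy =>
      deriv_smoothTransition_eq_zero hy).symm
  rw [h1, ← intervalIntegral.integral_of_le zero_le_one,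
    intervalIntegral.integral_deriv_eq_sub
      (fun x _ => (Real.smoothTransition.contDiff (n := 1)).differentiable (by simp) x)
      (continuous_deriv_smoothTransition.intervalIntegrable _ _)]
  simp

/-- The weights form an approximate identity concentrating at `s`: they have mass one and live on
`[s, s + 1/(n+1)]`, on the right of `s`, so only values of `U` on `[s, s + 1]` matter. After the
substitution `y = (n + 1)(τ - s)` this is dominated convergence. -/
theorem tendsto_integral_mul_deriv_smoothTransition {U : ℝ → ℝ} (hU : ContinuousOn U (Ioi 0))
    {s : ℝ} (hs : 0 < s) :
    Tendsto (fun n : ℕ => ∫ τ in Ioi (0 : ℝ),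
      U τ * ((n + 1 : ℝ) * deriv Real.smoothTransition ((n + 1 : ℝ) * (τ - s)))) atTop
      (𝓝 (U s)) := by
  have hrw : ∀ n : ℕ, ∫ τ in Ioi (0 : ℝ),
      U τ * ((n + 1 : ℝ) * deriv Real.smoothTransition ((n + 1 : ℝ) * (τ - s))) =
      ∫ y, (Ioi (0 : ℝ)).indicator U (s + y / (n + 1 : ℝ)) * deriv Real.smoothTransition y := by
    intro n
    have hn : (0 : ℝ) < n + 1 := by positivity
    set F : ℝ → ℝ := fun y => (Ioi (0 : ℝ)).indicator U (s + y / (n + 1 : ℝ)) *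
      deriv Real.smoothTransition y with hF
    have h1 : ∫ τ, F ((n + 1 : ℝ) * (τ - s)) = ∫ τ, F ((n + 1 : ℝ) * τ) :=
      integral_sub_right_eq_self (fun τ => F ((n + 1 : ℝ) * τ)) s
    rw [Measure.integral_comp_mul_left F (n + 1 : ℝ), abs_of_pos (inv_pos.2 hn), smul_eq_mul] at h1
    have h2 : ∫ y, F y = (n + 1 : ℝ) * ∫ τ, F ((n + 1 : ℝ) * (τ - s)) := by
      rw [h1]; field_simp
    rw [h2, ← integral_const_mul, ← integral_indicator measurableSet_Ioi]
    refine integral_congr_ae (Eventually.of_forall fun τ => ?_)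
    have e : s + (n + 1 : ℝ) * (τ - s) / (n + 1 : ℝ) = τ := by field_simp; ring
    simp only [hF, e]
    by_cases hτ : τ ∈ Ioi (0 : ℝ)
    · simp only [indicator_of_mem hτ]; ring
    · simp only [indicator_of_notMem hτ]; ring
  simp_rw [hrw]
  have hlim : U s = ∫ y, U s * deriv Real.smoothTransition y := by
    rw [integral_const_mul, integral_deriv_smoothTransition, mul_one]
  rw [hlim]
  have hUc : ContinuousOn U (Icc s (s + 1)) := hU.mono fun x hx => lt_of_lt_of_le hs hx.1
  obtain ⟨M, hM⟩ := isCompact_Icc.exists_bound_of_continuousOn hUc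
  have hint : Integrable (deriv Real.smoothTransition) :=
    continuous_deriv_smoothTransition.integrable_of_hasCompactSupport
      (HasCompactSupport.intro isCompact_Icc fun y hy => deriv_smoothTransition_eq_zero hy)
  have hmeas : Measurable ((Ioi (0 : ℝ)).indicator U) := by
    classical
    rw [← piecewise_eq_indicator]
    exact hU.measurable_piecewise continuous_zero.continuousOn measurableSet_Ioi
  refine tendsto_integral_of_dominated_convergence
    (fun y => M * ‖deriv Real.smoothTransition y‖) (fun n => ?_) (hint.norm.const_mul M)
    (fun n => Eventually.of_forall fun y => ?_) (Eventually.of_forall fun y => ?_)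
  · exact (hmeas.comp (by fun_prop)).aestronglyMeasurable.mul hint.aestronglyMeasurable
  · by_cases hy : y ∈ Icc (0 : ℝ) 1
    · have hn : (0 : ℝ) < n + 1 := by positivity
      have h1 : s + y / (n + 1 : ℝ) ∈ Icc s (s + 1) := by
        refine ⟨by have := div_nonneg hy.1 hn.le; linarith, ?_⟩
        have : y / (n + 1 : ℝ) ≤ 1 := (div_le_one hn).2 (by
          have : (0 : ℝ) ≤ n := by positivity
          linarith [hy.2])
        linarith
      rw [norm_mul, indicator_of_mem (show _ ∈ Ioi (0 : ℝ) from lt_of_lt_of_le hs h1.1)]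
      exact mul_le_mul_of_nonneg_right (hM _ h1) (norm_nonneg _)
    · simp [deriv_smoothTransition_eq_zero hy]
  · refine Tendsto.mul_const _ ?_
    have h1 : Tendsto (fun n : ℕ => s + y / (n + 1 : ℝ)) atTop (𝓝 s) := by
      have := (tendsto_one_div_add_atTop_nhds_zero_nat (𝕜 := ℝ)).const_mul y
      simpa [div_eq_mul_inv] using this.const_add s
    have hc : ContinuousAt ((Ioi (0 : ℝ)).indicator U) s := by
      refine (hU.continuousAt (Ioi_mem_nhds hs)).congr ?_
      filter_upwards [Ioi_mem_nhds hs] with x hx using (indicator_of_mem hx U).symm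
    have h2 := hc.tendsto.comp h1
    rwa [indicator_of_mem (show s ∈ Ioi (0 : ℝ) from hs)] at h2

/-- A continuous function whose distributional derivative on `(0,∞)` is locally integrable is a
primitive of it. -/
theorem sub_eq_neg_setIntegral_of_weak_deriv {U g : ℝ → ℝ} (hU : ContinuousOn U (Ioi 0))
    (hg : ∀ a b : ℝ, 0 < a → IntegrableOn g (Ioc a b))
    (h : ∀ η : ℝ → ℝ, ContDiff ℝ ∞ η → HasCompactSupport η → tsupport η ⊆ Ioi 0 →
      ∫ t in Ioi (0 : ℝ), U t * deriv η t = ∫ t in Ioi (0 : ℝ), η t * g t)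
    {s t : ℝ} (hs : 0 < s) (hst : s < t) :
    U t - U s = -∫ r in Ioc s t, g r := by
  -- Smooth approximations of the indicator of `(s, t]`; their derivatives are approximate Dirac
  -- masses at `s` and `t` with opposite signs.
  let η : ℕ → ℝ → ℝ := fun n τ => Real.smoothTransition ((n + 1 : ℝ) * (τ - s)) -
    Real.smoothTransition ((n + 1 : ℝ) * (τ - t))
  have hηd : ∀ n, ContDiff ℝ ∞ (η n) := fun n =>
    (Real.smoothTransition.contDiff.comp (by fun_prop)).sub
      (Real.smoothTransition.contDiff.comp (by fun_prop))
  have hη0 : ∀ n, ∀ τ, τ ∉ Ioc s (t + 1) → η n τ = 0 := by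
    intro n τ hτ
    have hn : (0 : ℝ) ≤ n := by positivity
    rw [mem_Ioc, not_and_or, not_lt, not_le] at hτ
    simp only [η]
    rcases hτ with h | h
    · rw [Real.smoothTransition.zero_of_nonpos, Real.smoothTransition.zero_of_nonpos, sub_zero]
      all_goals nlinarith
    · rw [Real.smoothTransition.one_of_one_le, Real.smoothTransition.one_of_one_le, sub_self]
      all_goals nlinarith
  have hηts : ∀ n, tsupport (η n) ⊆ Icc s (t + 1) := fun n =>
    closure_minimal (fun τ hτ => by
      by_contra hc
      exact hτ (hη0 n τ fun h => hc ⟨h.1.le, h.2⟩)) isClosed_Icc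
  have hηb : ∀ n τ, |η n τ| ≤ 1 := by
    intro n τ
    have a1 := Real.smoothTransition.nonneg ((n + 1 : ℝ) * (τ - s))
    have a2 := Real.smoothTransition.nonneg ((n + 1 : ℝ) * (τ - t))
    have a3 := Real.smoothTransition.le_one ((n + 1 : ℝ) * (τ - s))
    have a4 := Real.smoothTransition.le_one ((n + 1 : ℝ) * (τ - t))
    rw [abs_le]; constructor <;> simp only [η] <;> linarith
  have hE : ∀ n, ∫ τ in Ioi (0 : ℝ), U τ * deriv (η n) τ = ∫ τ in Ioi (0 : ℝ), η n τ * g τ :=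
    fun n => h _ (hηd n) (isCompact_Icc.of_isClosed_subset (isClosed_tsupport _) (hηts n))
      ((hηts n).trans fun x hx => lt_of_lt_of_le hs hx.1)
  have hSd : Differentiable ℝ Real.smoothTransition :=
    (Real.smoothTransition.contDiff (n := 1)).differentiable (by simp)
  have hd1 : ∀ (n : ℕ) (a τ : ℝ), HasDerivAt (fun x => Real.smoothTransition ((n + 1 : ℝ) * (x - a)))
      ((n + 1 : ℝ) * deriv Real.smoothTransition ((n + 1 : ℝ) * (τ - a))) τ := by
    intro n a τ
    have := ((hSd ((n + 1 : ℝ) * (τ - a))).hasDerivAt).comp τ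
      (((hasDerivAt_id τ).sub_const a).const_mul (n + 1 : ℝ))
    simpa [mul_comm, Function.comp_def] using this
  have hint : ∀ (n : ℕ) (a : ℝ), 0 < a → IntegrableOn (fun τ => U τ * ((n + 1 : ℝ) *
      deriv Real.smoothTransition ((n + 1 : ℝ) * (τ - a)))) (Ioi 0) := by
    intro n a ha
    have hn : (0 : ℝ) ≤ n := by positivity
    have h1 : IntegrableOn (fun τ => U τ * ((n + 1 : ℝ) *
        deriv Real.smoothTransition ((n + 1 : ℝ) * (τ - a)))) (Icc a (a + 1)) := by
      refine ContinuousOn.integrableOn_compact isCompact_Icc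
        ((hU.mono fun x hx => lt_of_lt_of_le ha hx.1).mul ?_)
      exact (continuous_const.mul (continuous_deriv_smoothTransition.comp
        (by fun_prop))).continuousOn
    refine (h1.of_forall_sdiff_eq_zero measurableSet_Ioi fun τ hτ => ?_)
    rw [deriv_smoothTransition_eq_zero, mul_zero, mul_zero]
    intro hc
    refine hτ.2 ⟨?_, ?_⟩
    · by_contra h'
      nlinarith [hc.1]
    · by_contra h'
      nlinarith [hc.2]
  have hL : Tendsto (fun n => ∫ τ in Ioi (0 : ℝ), U τ * deriv (η n) τ) atTop (𝓝 (U s - U t)) := by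
    have := (tendsto_integral_mul_deriv_smoothTransition hU hs).sub
      (tendsto_integral_mul_deriv_smoothTransition hU (hs.trans hst))
    refine this.congr fun n => ?_
    rw [← integral_sub (hint n s hs) (hint n t (hs.trans hst))]
    refine integral_congr_ae (Eventually.of_forall fun τ => ?_)
    simp only [η]
    rw [((hd1 n s τ).fun_sub (hd1 n t τ)).deriv]
    ring
  have hgi := hg s (t + 1) hs
  have hgi' : Integrable ((Ioc s (t + 1)).indicator g) :=
    (integrable_indicator_iff measurableSet_Ioc).2 hgi
  have hR : Tendsto (fun n => ∫ τ in Ioi (0 : ℝ), η n τ * g τ) atTop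
      (𝓝 (∫ r in Ioc s t, g r)) := by
    have e : ∀ n, ∫ τ in Ioi (0 : ℝ), η n τ * g τ = ∫ τ, η n τ * (Ioc s (t + 1)).indicator g τ := by
      intro n
      rw [← integral_indicator measurableSet_Ioi]
      refine integral_congr_ae (Eventually.of_forall fun τ => ?_)
      by_cases hτ : τ ∈ Ioc s (t + 1)
      · simp [indicator_of_mem hτ, indicator_of_mem (show τ ∈ Ioi (0 : ℝ) from hs.trans hτ.1)]
      · simp [indicator_apply, hη0 n τ hτ]
    simp_rw [e]
    rw [← integral_indicator measurableSet_Ioc]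
    refine tendsto_integral_of_dominated_convergence
      (fun τ => ‖(Ioc s (t + 1)).indicator g τ‖) (fun n => ?_) hgi'.norm
      (fun n => Eventually.of_forall fun τ => ?_) (Eventually.of_forall fun τ => ?_)
    · exact (hηd n).continuous.aestronglyMeasurable.mul hgi'.aestronglyMeasurable
    · rw [norm_mul]
      exact mul_le_of_le_one_left (norm_nonneg _) (hηb n τ)
    -- The transition vanishes at `0`, so the limit is the indicator of `Ioc s t` at every point,
    -- endpoints included.
    · have hbig : ∀ a : ℝ, a < τ → ∀ᶠ n : ℕ in atTop,
          Real.smoothTransition ((n + 1 : ℝ) * (τ - a)) = 1 := by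
        intro a ha
        have : Tendsto (fun n : ℕ => ((n : ℝ) + 1) * (τ - a)) atTop atTop :=
          (tendsto_atTop_add_const_right _ _ tendsto_natCast_atTop_atTop).atTop_mul_const
            (sub_pos.2 ha)
        filter_upwards [this.eventually_ge_atTop 1] with n hn using
          Real.smoothTransition.one_of_one_le hn
      have hsmall : ∀ a : ℝ, τ ≤ a → ∀ n : ℕ,
          Real.smoothTransition ((n + 1 : ℝ) * (τ - a)) = 0 := fun a ha n =>
        Real.smoothTransition.zero_of_nonpos
          (mul_nonpos_of_nonneg_of_nonpos (by positivity) (sub_nonpos.2 ha))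
      refine tendsto_const_nhds.congr' ?_
      by_cases h1 : s < τ
      · by_cases h2 : τ ≤ t
        · filter_upwards [hbig s h1] with n hn
          simp only [η, hn, hsmall t h2 n]
          simp [h1, h2, h2.trans (by linarith : t ≤ t + 1)]
        · filter_upwards [hbig s h1, hbig t (not_le.1 h2)] with n hn hn'
          simp only [η, hn, hn']
          simp [indicator_apply, h2]
      · exact Eventually.of_forall fun n => by simp [h1]
  have := tendsto_nhds_unique (hL.congr hE) hR
  linarith

/-! ### Gagliardo quotients and spatial cutoffs -/

section

/-- The symmetrized difference quotient whose `L²` norm is the Gagliardo seminorm. -/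
noncomputable def gagliardoQuotient {N : ℕ} (σ : ℝ) (f : EuclideanSpace ℝ (Fin N) → ℝ)
    (p : EuclideanSpace ℝ (Fin N) × EuclideanSpace ℝ (Fin N)) : ℝ :=
  (f p.1 - f p.2) * ‖p.1 - p.2‖ ^ (-(((N : ℝ) + σ) / 2))

theorem rpow_neg_half_sq {N : ℕ} {σ r : ℝ} (hr : 0 ≤ r) :
    (r ^ (-(((N : ℝ) + σ) / 2))) ^ 2 = r ^ (-((N : ℝ) + σ)) := by
  rw [← Real.rpow_natCast, ← Real.rpow_mul hr]
  congr 1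
  push_cast
  ring

/-- Splitting the singular weight evenly between the two factors turns the energy into a weighted
`L²` pairing, to which Cauchy–Schwarz applies. -/
theorem gagliardoQuotient_mul {N : ℕ} {σ : ℝ} (f g : EuclideanSpace ℝ (Fin N) → ℝ)
    (p : EuclideanSpace ℝ (Fin N) × EuclideanSpace ℝ (Fin N)) :
    gagliardoQuotient σ f p * gagliardoQuotient σ g p =
      (f p.1 - f p.2) * (g p.1 - g p.2) * ‖p.1 - p.2‖ ^ (-((N : ℝ) + σ)) := by
  rw [← rpow_neg_half_sq (norm_nonneg _)]
  simp only [gagliardoQuotient]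
  ring

theorem gagliardoSq_eq {N : ℕ} (σ : ℝ) (f : EuclideanSpace ℝ (Fin N) → ℝ) :
    gagliardoSq σ f = ∫⁻ p, ENNReal.ofReal (gagliardoQuotient σ f p ^ 2)
      ∂((volume : Measure (EuclideanSpace ℝ (Fin N))).prod volume) := by
  unfold gagliardoSq
  congr 1; ext p
  rw [sq (gagliardoQuotient σ f p), gagliardoQuotient_mul, Real.rpow_neg (norm_nonneg _), sq,
    div_eq_mul_inv]

theorem measurable_gagliardoQuotient {N : ℕ} (σ : ℝ) {f : EuclideanSpace ℝ (Fin N) → ℝ}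
    (hf : Measurable f) : Measurable (gagliardoQuotient σ f) := by
  unfold gagliardoQuotient
  fun_prop

theorem memLp_two_iff_lintegral_sq_lt_top {α : Type*} [MeasurableSpace α] {μ : Measure α}
    {f : α → ℝ} (hf : AEStronglyMeasurable f μ) :
    MemLp f 2 μ ↔ ∫⁻ x, ENNReal.ofReal (f x ^ 2) ∂μ < ⊤ := by
  rw [memLp_two_iff_integrable_sq hf]
  refine ⟨fun h => h.lintegral_lt_top, fun h => ⟨hf.pow 2, ?_⟩⟩
  rw [hasFiniteIntegral_iff_enorm]
  refine lt_of_le_of_lt (lintegral_mono fun x => ?_) h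
  rw [Real.enorm_eq_ofReal_abs, abs_of_nonneg (sq_nonneg _)]

/-- The Lipschitz cutoff equal to `1` on the ball of radius `n + 1`. -/
noncomputable def cutoff {N : ℕ} (n : ℕ) (x : EuclideanSpace ℝ (Fin N)) : ℝ :=
  max 0 (min 1 (2 - ‖x‖ / (n + 1 : ℝ)))

theorem cutoff_nonneg {N : ℕ} (n : ℕ) (x : EuclideanSpace ℝ (Fin N)) : 0 ≤ cutoff n x :=
  le_max_left _ _

theorem cutoff_le_one {N : ℕ} (n : ℕ) (x : EuclideanSpace ℝ (Fin N)) : cutoff n x ≤ 1 :=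
  max_le zero_le_one (min_le_left _ _)

theorem continuous_cutoff {N : ℕ} (n : ℕ) :
    Continuous (cutoff n : EuclideanSpace ℝ (Fin N) → ℝ) := by
  unfold cutoff; fun_prop

theorem tendsto_cutoff {N : ℕ} (x : EuclideanSpace ℝ (Fin N)) :
    Tendsto (fun n => cutoff n x) atTop (𝓝 1) := by
  refine tendsto_const_nhds.congr' ?_
  filter_upwards [eventually_ge_atTop ⌈‖x‖⌉₊] with n hn
  have h1 : ‖x‖ ≤ n := (Nat.le_ceil _).trans (by exact_mod_cast hn)
  have h2 : ‖x‖ / (n + 1 : ℝ) ≤ 1 := (div_le_one (by positivity)).2 (by linarith)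
  rw [cutoff, min_eq_left (by linarith), max_eq_right zero_le_one]

theorem cutoff_eq_zero {N : ℕ} {n : ℕ} {x : EuclideanSpace ℝ (Fin N)}
    (hx : 2 * (n + 1 : ℝ) ≤ ‖x‖) : cutoff n x = 0 := by
  have h2 : 2 ≤ ‖x‖ / (n + 1 : ℝ) := (le_div_iff₀ (by positivity)).2 hx
  rw [cutoff, max_eq_left]
  exact (min_le_right _ _).trans (by linarith)

/-- The slope is `1/(n+1) ≤ 1`, so the bound is uniform in `n`; its square is integrable against
`|z|^(-(N+σ))`. -/
theorem abs_cutoff_sub_le {N : ℕ} (n : ℕ) (x y : EuclideanSpace ℝ (Fin N)) :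
    |cutoff n x - cutoff n y| ≤ min 1 ‖x - y‖ := by
  refine le_min ?_ ?_
  · rw [abs_le]
    constructor <;> linarith [cutoff_nonneg n x, cutoff_nonneg n y, cutoff_le_one n x,
      cutoff_le_one n y]
  · unfold cutoff
    rw [max_comm 0, max_comm 0, min_comm 1, min_comm 1]
    refine (abs_max_sub_max_le_abs _ _ _).trans ((abs_min_sub_min_le_max _ _ _ _).trans
      (max_le ?_ (by simp)))
    rw [sub_sub_sub_cancel_left, ← sub_div, abs_div, abs_of_pos (by positivity : (0 : ℝ) < n + 1)]
    refine (div_le_self (abs_nonneg _) (by simp)).trans ?_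
    rw [norm_sub_rev]
    exact abs_norm_sub_norm_le _ _

variable {N : ℕ} {σ : ℝ}

/-- Dominated convergence. By the discrete product rule the difference splits into the quotient of
`v` times a bounded factor, and `v` times the quotient of the cutoff; the second is dominated
through the Lévy condition and `v ∈ L²`. -/
theorem tendsto_gagliardoQuotient_cutoff_mul (hN : N ≠ 0) (hσ : σ ∈ Ioo (0 : ℝ) 2)
    {v : EuclideanSpace ℝ (Fin N) → ℝ} (hv : Measurable v) (hv2 : MemLp v 2 volume)
    (hD : MemLp (gagliardoQuotient σ v) 2 (volume.prod volume)) :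
    Tendsto (fun n => ∫⁻ p, ENNReal.ofReal ((gagliardoQuotient σ (fun x => cutoff n x * v x) p -
      gagliardoQuotient σ v p) ^ 2) ∂(volume.prod volume)) atTop (𝓝 0) := by
  have hne : Nontrivial (EuclideanSpace ℝ (Fin N)) := by
    have : Nonempty (Fin N) := Fin.pos_iff_nonempty.1 (Nat.pos_of_ne_zero hN)
    infer_instance
  let H : EuclideanSpace ℝ (Fin N) → ℝ≥0∞ := fun z =>
    ENNReal.ofReal (min 1 ‖z‖ ^ 2 * ‖z‖ ^ (-((N : ℝ) + σ)))
  have hHm : Measurable H := by fun_prop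
  have hH : ∫⁻ z, H z < ⊤ := by
    have := lintegral_min_one_sq_mul_rpow_lt_top (volume : Measure (EuclideanSpace ℝ (Fin N))) hσ
    rwa [finrank_euclideanSpace_fin] at this
  let G : EuclideanSpace ℝ (Fin N) × EuclideanSpace ℝ (Fin N) → ℝ≥0∞ := fun p =>
    ENNReal.ofReal 2 * ENNReal.ofReal (gagliardoQuotient σ v p ^ 2) +
      ENNReal.ofReal 2 * (ENNReal.ofReal (v p.1 ^ 2) * H (p.1 - p.2))
  have hGm1 : Measurable fun p => ENNReal.ofReal (gagliardoQuotient σ v p ^ 2) :=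
    ((measurable_gagliardoQuotient σ hv).pow_const 2).ennreal_ofReal
  have hGm2 : Measurable fun p : EuclideanSpace ℝ (Fin N) × EuclideanSpace ℝ (Fin N) =>
      ENNReal.ofReal (v p.1 ^ 2) * H (p.1 - p.2) := by fun_prop
  have hG : ∫⁻ p, G p ∂(volume.prod volume) ≠ ⊤ := by
    rw [lintegral_add_left (hGm1.const_mul _), lintegral_const_mul _ hGm1,
      lintegral_const_mul _ hGm2]
    refine ENNReal.add_ne_top.2 ⟨ENNReal.mul_ne_top (by simp)
      ((memLp_two_iff_lintegral_sq_lt_top hD.1).1 hD).ne, ENNReal.mul_ne_top (by simp) ?_⟩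
    rw [lintegral_prod _ hGm2.aemeasurable]
    have : ∀ x, ∫⁻ y, ENNReal.ofReal (v x ^ 2) * H (x - y) ∂volume =
        ENNReal.ofReal (v x ^ 2) * ∫⁻ z, H z ∂volume := by
      intro x
      rw [lintegral_const_mul _ (by fun_prop),
        lintegral_sub_left_eq_self (μ := (volume : Measure (EuclideanSpace ℝ (Fin N)))) H x]
    simp_rw [this]
    rw [lintegral_mul_const _ (by fun_prop)]
    exact ENNReal.mul_ne_top ((memLp_two_iff_lintegral_sq_lt_top hv2.1).1 hv2).ne hH.ne
  rw [← lintegral_zero (μ := (volume : Measure (EuclideanSpace ℝ (Fin N))).prod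
    (volume : Measure (EuclideanSpace ℝ (Fin N))))]
  refine tendsto_lintegral_of_dominated_convergence G (fun n => ?_) (fun n => ?_) hG ?_
  · exact (((measurable_gagliardoQuotient σ ((continuous_cutoff n).measurable.mul hv)).sub
      (measurable_gagliardoQuotient σ hv)).pow_const 2).ennreal_ofReal
  · refine Eventually.of_forall fun p => ?_
    simp only [G, H]
    rw [← ENNReal.ofReal_mul (sq_nonneg _),
      ← ENNReal.ofReal_mul (by norm_num), ← ENNReal.ofReal_mul (by norm_num),
      ← ENNReal.ofReal_add (by positivity) (by positivity)]
    refine ENNReal.ofReal_le_ofReal ?_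
    rw [← rpow_neg_half_sq (norm_nonneg _)]
    set κ := ‖p.1 - p.2‖ ^ (-(((N : ℝ) + σ) / 2)) with hκ
    have e : gagliardoQuotient σ (fun x => cutoff n x * v x) p - gagliardoQuotient σ v p =
        (cutoff n p.2 - 1) * gagliardoQuotient σ v p +
          v p.1 * ((cutoff n p.1 - cutoff n p.2) * κ) := by
      simp only [gagliardoQuotient, ← hκ]; ring
    rw [e]
    have h1 : ((cutoff n p.2 - 1) * gagliardoQuotient σ v p) ^ 2 ≤
        gagliardoQuotient σ v p ^ 2 := by
      rw [mul_pow]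
      refine mul_le_of_le_one_left (sq_nonneg _) ?_
      nlinarith [cutoff_nonneg n p.2, cutoff_le_one n p.2]
    have h2 : (v p.1 * ((cutoff n p.1 - cutoff n p.2) * κ)) ^ 2 ≤
        v p.1 ^ 2 * (min 1 ‖p.1 - p.2‖ ^ 2 * κ ^ 2) := by
      rw [mul_pow, mul_pow]
      refine mul_le_mul_of_nonneg_left (mul_le_mul_of_nonneg_right ?_ (sq_nonneg _)) (sq_nonneg _)
      rw [← sq_abs]
      exact pow_le_pow_left₀ (abs_nonneg _) (abs_cutoff_sub_le _ _ _) 2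
    nlinarith [sq_nonneg ((cutoff n p.2 - 1) * gagliardoQuotient σ v p -
      v p.1 * ((cutoff n p.1 - cutoff n p.2) * κ))]
  · refine Eventually.of_forall fun p => ?_
    have : Tendsto (fun n => (gagliardoQuotient σ (fun x => cutoff n x * v x) p -
        gagliardoQuotient σ v p) ^ 2) atTop (𝓝 ((((1 * v p.1 - 1 * v p.2) *
          ‖p.1 - p.2‖ ^ (-(((N : ℝ) + σ) / 2))) - gagliardoQuotient σ v p) ^ 2)) :=
      ((((((tendsto_cutoff p.1).mul_const _).sub ((tendsto_cutoff p.2).mul_const _)).mul_const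
        _).sub_const _).pow 2)
    have h2 := ENNReal.tendsto_ofReal this
    simpa [gagliardoQuotient] using h2

end

/-! ### Mollification and density of test functions -/

section

open scoped Convolution in
/-- The convolution of `v` with the normalized bump function `ψ`. -/
noncomputable def mollify {N : ℕ} (ψ : ContDiffBump (0 : EuclideanSpace ℝ (Fin N)))
    (v : EuclideanSpace ℝ (Fin N) → ℝ) : EuclideanSpace ℝ (Fin N) → ℝ :=
  ψ.normed volume ⋆[ContinuousLinearMap.lsmul ℝ ℝ, volume] v

variable {N : ℕ} {σ : ℝ}

theorem mollify_apply (ψ : ContDiffBump (0 : EuclideanSpace ℝ (Fin N)))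
    (v : EuclideanSpace ℝ (Fin N) → ℝ) (x : EuclideanSpace ℝ (Fin N)) :
    mollify ψ v x = ∫ z, ψ.normed volume z * v (x - z) := rfl

theorem integrable_normed_mul (ψ : ContDiffBump (0 : EuclideanSpace ℝ (Fin N)))
    {F : EuclideanSpace ℝ (Fin N) → ℝ} (hF : Measurable F) {B : ℝ} (hB : ∀ x, |F x| ≤ B) :
    Integrable (fun z => ψ.normed volume z * F z) :=
  (ψ.integrable_normed (μ := volume)).mul_bdd hF.aestronglyMeasurable
    (Eventually.of_forall hB)

theorem abs_mollify_le (ψ : ContDiffBump (0 : EuclideanSpace ℝ (Fin N)))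
    {v : EuclideanSpace ℝ (Fin N) → ℝ} {B : ℝ} (hB : ∀ x, |v x| ≤ B)
    (x : EuclideanSpace ℝ (Fin N)) : |mollify ψ v x| ≤ B := by
  rw [mollify_apply, ← Real.norm_eq_abs]
  refine (norm_integral_le_of_norm_le ((ψ.integrable_normed (μ := volume)).mul_const B)
    (Eventually.of_forall fun z => ?_)).trans_eq ?_
  · rw [norm_mul, Real.norm_of_nonneg (ψ.nonneg_normed z)]
    exact mul_le_mul_of_nonneg_left (hB _) (ψ.nonneg_normed z)
  · rw [integral_mul_const, ψ.integral_normed, one_mul]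

/-- Jensen's inequality for the probability density `ψ.normed volume`, obtained from the
nonnegativity of the variance. -/
theorem sq_integral_normed_mul_le (ψ : ContDiffBump (0 : EuclideanSpace ℝ (Fin N)))
    {F : EuclideanSpace ℝ (Fin N) → ℝ} (hF : Measurable F) {B : ℝ} (hB : ∀ x, |F x| ≤ B) :
    ENNReal.ofReal ((∫ z, ψ.normed volume z * F z) ^ 2) ≤
      ∫⁻ z, ENNReal.ofReal (ψ.normed volume z) * ENNReal.ofReal (F z ^ 2) := by
  set c := ∫ z, ψ.normed volume z * F z with hc
  have i1 := integrable_normed_mul ψ hF hB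
  have i2 : Integrable (fun z => ψ.normed volume z * F z ^ 2) :=
    integrable_normed_mul ψ (hF.pow_const 2) (B := B ^ 2) fun x => by
      rw [abs_pow]; exact pow_le_pow_left₀ (abs_nonneg _) (hB x) 2
  have i3 := ψ.integrable_normed (μ := (volume : Measure (EuclideanSpace ℝ (Fin N))))
  have h0 : 0 ≤ ∫ z, ψ.normed volume z * (F z - c) ^ 2 :=
    integral_nonneg fun z => mul_nonneg (ψ.nonneg_normed z) (sq_nonneg _)
  have h1 : ∫ z, ψ.normed volume z * (F z - c) ^ 2 =
      (∫ z, ψ.normed volume z * F z ^ 2) - 2 * c * c + c ^ 2 * 1 := by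
    have e : ∀ z, ψ.normed volume z * (F z - c) ^ 2 = ψ.normed volume z * F z ^ 2 -
        2 * c * (ψ.normed volume z * F z) + c ^ 2 * ψ.normed volume z := fun z => by ring
    have i4 : Integrable (fun z => ψ.normed volume z * F z ^ 2 -
        2 * c * (ψ.normed volume z * F z)) := i2.sub (i1.const_mul _)
    simp_rw [e]
    rw [integral_add i4 (i3.const_mul _),
      integral_sub i2 (i1.const_mul _), integral_const_mul, integral_const_mul,
      ψ.integral_normed, ← hc]
  have h2 : c ^ 2 ≤ ∫ z, ψ.normed volume z * F z ^ 2 := by nlinarith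
  refine (ENNReal.ofReal_le_ofReal h2).trans_eq ?_
  rw [ofReal_integral_eq_lintegral_ofReal i2
    (Eventually.of_forall fun z => mul_nonneg (ψ.nonneg_normed z) (sq_nonneg _))]
  congr 1; ext z
  rw [ENNReal.ofReal_mul (ψ.nonneg_normed z)]

/-- The weight depends only on `p.1 - p.2`, so taking quotients commutes with the diagonal
translations `(p.1 - z, p.2 - z)`, hence with averaging over them. -/
theorem gagliardoQuotient_mollify_sub (ψ : ContDiffBump (0 : EuclideanSpace ℝ (Fin N)))
    {v : EuclideanSpace ℝ (Fin N) → ℝ} (hv : Measurable v) {B : ℝ} (hB : ∀ x, |v x| ≤ B)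
    (p : EuclideanSpace ℝ (Fin N) × EuclideanSpace ℝ (Fin N)) :
    gagliardoQuotient σ (mollify ψ v) p - gagliardoQuotient σ v p =
      ∫ z, ψ.normed volume z *
        (gagliardoQuotient σ v (p.1 - z, p.2 - z) - gagliardoQuotient σ v p) := by
  have i : ∀ x, Integrable (fun z => ψ.normed volume z * v (x - z)) := fun x =>
    integrable_normed_mul ψ (hv.comp (by fun_prop)) fun z => hB (x - z)
  have i3 := ψ.integrable_normed (μ := (volume : Measure (EuclideanSpace ℝ (Fin N))))
  simp only [gagliardoQuotient, mollify_apply, sub_sub_sub_cancel_right]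
  set κ := ‖p.1 - p.2‖ ^ (-(((N : ℝ) + σ) / 2))
  have e : ∀ z, ψ.normed volume z * ((v (p.1 - z) - v (p.2 - z)) * κ - (v p.1 - v p.2) * κ) =
      (ψ.normed volume z * v (p.1 - z) - ψ.normed volume z * v (p.2 - z)) * κ -
        ψ.normed volume z * ((v p.1 - v p.2) * κ) := fun z => by ring
  have i4 : Integrable (fun z => (ψ.normed volume z * v (p.1 - z) -
      ψ.normed volume z * v (p.2 - z)) * κ) := ((i _).sub (i _)).mul_const _
  simp_rw [e]
  rw [integral_sub i4 (i3.mul_const _), integral_mul_const,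
    integral_sub (i _) (i _), integral_mul_const, ψ.integral_normed, one_mul]

/-- Jensen and Tonelli bound the error by an average over small `z` of the squared `L²` distance
between the quotient of `v` and its diagonal translate, which tends to zero with `z`. -/
theorem tendsto_gagliardoQuotient_mollify
    {ψ : ℕ → ContDiffBump (0 : EuclideanSpace ℝ (Fin N))}
    (hψ : Tendsto (fun n => (ψ n).rOut) atTop (𝓝 0))
    {v : EuclideanSpace ℝ (Fin N) → ℝ} (hv : Measurable v) {B : ℝ} (hB : ∀ x, |v x| ≤ B)
    (hD : MemLp (gagliardoQuotient σ v) 2 (volume.prod volume)) :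
    Tendsto (fun n => ∫⁻ p, ENNReal.ofReal ((gagliardoQuotient σ (mollify (ψ n) v) p -
      gagliardoQuotient σ v p) ^ 2) ∂(volume.prod volume)) atTop (𝓝 0) := by
  let T : EuclideanSpace ℝ (Fin N) → EuclideanSpace ℝ (Fin N) × EuclideanSpace ℝ (Fin N) →
    EuclideanSpace ℝ (Fin N) × EuclideanSpace ℝ (Fin N) := fun z p => (p.1 - z, p.2 - z)
  have hTm : ∀ z, MeasurePreserving (T z) (volume.prod volume) (volume.prod volume) := fun z =>
    (measurePreserving_sub_right volume z).prod (measurePreserving_sub_right volume z)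
  have hT := tendsto_lintegral_comp_sub_sq T (by fun_prop) hTm 0 (by simp [T]) hD
  have hDm := measurable_gagliardoQuotient σ hv
  rw [ENNReal.tendsto_nhds_zero] at hT ⊢
  intro ε hε
  obtain ⟨δ, hδ, hδ'⟩ := Metric.eventually_nhds_iff_ball.1 (hT ε hε)
  filter_upwards [hψ.eventually (gt_mem_nhds hδ)] with n hn
  have hpm : Measurable fun q : (EuclideanSpace ℝ (Fin N) × EuclideanSpace ℝ (Fin N)) ×
      EuclideanSpace ℝ (Fin N) => ENNReal.ofReal ((ψ n).normed volume q.2) *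
        ENNReal.ofReal ((gagliardoQuotient σ v (T q.2 q.1) - gagliardoQuotient σ v q.1) ^ 2) := by
    have m1 : Measurable fun q : (EuclideanSpace ℝ (Fin N) × EuclideanSpace ℝ (Fin N)) ×
        EuclideanSpace ℝ (Fin N) => ENNReal.ofReal ((ψ n).normed volume q.2) :=
      ((ψ n).continuous_normed.measurable.comp measurable_snd).ennreal_ofReal
    have m2 : Measurable fun q : (EuclideanSpace ℝ (Fin N) × EuclideanSpace ℝ (Fin N)) ×
        EuclideanSpace ℝ (Fin N) => gagliardoQuotient σ v (T q.2 q.1) :=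
      hDm.comp (by fun_prop)
    exact m1.mul (((m2.sub (hDm.comp measurable_fst)).pow_const 2).ennreal_ofReal)
  calc ∫⁻ p, ENNReal.ofReal ((gagliardoQuotient σ (mollify (ψ n) v) p -
        gagliardoQuotient σ v p) ^ 2) ∂(volume.prod volume)
      ≤ ∫⁻ p, (∫⁻ z, ENNReal.ofReal ((ψ n).normed volume z) *
        ENNReal.ofReal ((gagliardoQuotient σ v (T z p) - gagliardoQuotient σ v p) ^ 2))
          ∂(volume.prod volume) := by
        refine lintegral_mono fun p => ?_
        rw [gagliardoQuotient_mollify_sub (ψ n) hv hB p]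
        set κ := ‖p.1 - p.2‖ ^ (-(((N : ℝ) + σ) / 2)) with hκ
        refine sq_integral_normed_mul_le (ψ n)
          (F := fun z => gagliardoQuotient σ v (p.1 - z, p.2 - z) - gagliardoQuotient σ v p)
          -- This bound is used only for integrability in `z` at fixed `p`; its blow-up near the
          -- diagonal is harmless.
          (B := 4 * B * κ) ((hDm.comp (by fun_prop)).sub_const _) (fun z => ?_)
        have e : gagliardoQuotient σ v (p.1 - z, p.2 - z) - gagliardoQuotient σ v p =
            ((v (p.1 - z) - v (p.2 - z)) - (v p.1 - v p.2)) * κ := by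
          simp only [gagliardoQuotient, sub_sub_sub_cancel_right, ← hκ]; ring
        have hκ0 : 0 ≤ κ := Real.rpow_nonneg (norm_nonneg _) _
        rw [e, abs_mul, abs_of_nonneg hκ0]
        refine mul_le_mul_of_nonneg_right ?_ hκ0
        have := fun x => abs_le.1 (hB x)
        rw [abs_le]
        constructor <;> linarith [(this (p.1 - z)).1, (this (p.1 - z)).2, (this (p.2 - z)).1,
          (this (p.2 - z)).2, (this p.1).1, (this p.1).2, (this p.2).1, (this p.2).2]
    _ = ∫⁻ z, ENNReal.ofReal ((ψ n).normed volume z) *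
        (∫⁻ p, ENNReal.ofReal ((gagliardoQuotient σ v (T z p) - gagliardoQuotient σ v p) ^ 2)
          ∂(volume.prod volume)) := by
        rw [lintegral_lintegral_swap hpm.aemeasurable]
        refine lintegral_congr fun z => ?_
        exact lintegral_const_mul _
          (((hDm.comp (hTm z).measurable).sub hDm).pow_const 2).ennreal_ofReal
    _ ≤ ∫⁻ z, ENNReal.ofReal ((ψ n).normed volume z) * ε := by
        refine lintegral_mono fun z => ?_
        by_cases hz : z ∈ Metric.ball (0 : EuclideanSpace ℝ (Fin N)) (ψ n).rOut
        · exact mul_le_mul_right (hδ' z (Metric.ball_subset_ball hn.le hz)) _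
        · rw [← (ψ n).support_normed_eq (μ := volume), Function.notMem_support] at hz
          simp [hz]
    _ = ε := by
        rw [lintegral_mul_const _ (ψ n).continuous_normed.measurable.ennreal_ofReal,
          ← ofReal_integral_eq_lintegral_ofReal (ψ n).integrable_normed
          (Eventually.of_forall fun z => (ψ n).nonneg_normed z), (ψ n).integral_normed]
        simp

theorem memLp_gagliardoQuotient_of_sub {v w : EuclideanSpace ℝ (Fin N) → ℝ} (hv : Measurable v)
    (hw : Measurable w) (hD : MemLp (gagliardoQuotient σ v) 2 (volume.prod volume))
    (h : ∫⁻ p, ENNReal.ofReal ((gagliardoQuotient σ w p - gagliardoQuotient σ v p) ^ 2)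
      ∂(volume.prod volume) < ⊤) :
    MemLp (gagliardoQuotient σ w) 2 (volume.prod volume) := by
  have hm := ((measurable_gagliardoQuotient σ hw).sub (measurable_gagliardoQuotient σ hv))
  have := ((memLp_two_iff_lintegral_sq_lt_top hm.aestronglyMeasurable).2 h).add hD
  simpa using this

/-- To prove a property of all bounded integrable functions with finite Gagliardo seminorm it is
enough to prove it for test functions, and to show that it is stable under bounded convergence
almost everywhere combined with convergence in the seminorm. -/
theorem induction_on_smooth (hN : N ≠ 0) (hσ : σ ∈ Ioo (0 : ℝ) 2)
    {P : (EuclideanSpace ℝ (Fin N) → ℝ) → Prop}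
    (smooth : ∀ v, ContDiff ℝ ∞ v → HasCompactSupport v →
      MemLp (gagliardoQuotient σ v) 2 (volume.prod volume) → P v)
    (lim : ∀ (v : EuclideanSpace ℝ (Fin N) → ℝ) (w : ℕ → EuclideanSpace ℝ (Fin N) → ℝ) (B : ℝ),
      Measurable v → (∀ n, Measurable (w n)) → (∀ n x, |w n x| ≤ B) →
      (∀ᵐ x, Tendsto (fun n => w n x) atTop (𝓝 (v x))) →
      MemLp (gagliardoQuotient σ v) 2 (volume.prod volume) →
      (∀ n, MemLp (gagliardoQuotient σ (w n)) 2 (volume.prod volume)) →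
      Tendsto (fun n => ∫⁻ p, ENNReal.ofReal ((gagliardoQuotient σ (w n) p -
        gagliardoQuotient σ v p) ^ 2) ∂(volume.prod volume)) atTop (𝓝 0) →
      (∀ n, P (w n)) → P v)
    {v : EuclideanSpace ℝ (Fin N) → ℝ} (hv : Measurable v) {B : ℝ} (hB : ∀ x, |v x| ≤ B)
    (hvi : Integrable v) (hD : MemLp (gagliardoQuotient σ v) 2 (volume.prod volume)) : P v := by
  -- Mollification handles compactly supported functions; the general case then follows by cutting
  -- off.
  have step : ∀ v : EuclideanSpace ℝ (Fin N) → ℝ, Measurable v → (∀ x, |v x| ≤ B) →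
      Integrable v → HasCompactSupport v →
      MemLp (gagliardoQuotient σ v) 2 (volume.prod volume) → P v := by
    intro v hv hB hvi hvc hD
    let ψ : ℕ → ContDiffBump (0 : EuclideanSpace ℝ (Fin N)) := fun n =>
      ⟨1 / (n + 1 : ℝ), 2 * (1 / (n + 1 : ℝ)), by positivity, by
        have : 0 < 1 / (n + 1 : ℝ) := by positivity
        linarith⟩
    have hψ : Tendsto (fun n => (ψ n).rOut) atTop (𝓝 0) := by
      simpa [ψ] using (tendsto_one_div_add_atTop_nhds_zero_nat (𝕜 := ℝ)).const_mul 2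
    have hae := ContDiffBump.ae_convolution_tendsto_right_of_locallyIntegrable
      (μ := (volume : Measure (EuclideanSpace ℝ (Fin N)))) (g := v) (K := 2) hψ
      (Eventually.of_forall fun n => le_rfl) hvi.locallyIntegrable
    have hT := tendsto_gagliardoQuotient_mollify hψ hv hB hD
    have hsm : ∀ n, ContDiff ℝ ∞ (mollify (ψ n) v) := fun n =>
      (ψ n).hasCompactSupport_normed.contDiff_convolution_left _ (ψ n).contDiff_normed
        hvi.locallyIntegrable
    have hcs : ∀ n, HasCompactSupport (mollify (ψ n) v) := fun n =>
      (ψ n).hasCompactSupport_normed.convolution _ hvc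
    -- Convergence in the seminorm gives finiteness of the approximants' seminorms only eventually,
    -- so the sequence is shifted by `n₀`.
    obtain ⟨n₀, hn₀⟩ := eventually_atTop.1 (hT.eventually (gt_mem_nhds ENNReal.zero_lt_top))
    have hDn : ∀ n, MemLp (gagliardoQuotient σ (mollify (ψ (n + n₀)) v)) 2
        (volume.prod volume) := fun n =>
      memLp_gagliardoQuotient_of_sub hv (hsm _).continuous.measurable hD (hn₀ _ (by omega))
    refine lim v (fun n => mollify (ψ (n + n₀)) v) B hv
      (fun n => (hsm _).continuous.measurable) (fun n x => abs_mollify_le _ hB x) ?_ hD hDn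
      (hT.comp (tendsto_add_atTop_nat n₀)) (fun n => smooth _ (hsm _) (hcs _) (hDn n))
    filter_upwards [hae] with x hx using hx.comp (tendsto_add_atTop_nat n₀)
  have hv2 : MemLp v 2 volume := by
    refine (memLp_two_iff_integrable_sq hvi.aestronglyMeasurable).2 ?_
    simp_rw [sq]
    exact hvi.mul_bdd hvi.aestronglyMeasurable (Eventually.of_forall hB)
  have hT := tendsto_gagliardoQuotient_cutoff_mul hN hσ hv hv2 hD
  obtain ⟨n₀, hn₀⟩ := eventually_atTop.1 (hT.eventually (gt_mem_nhds ENNReal.zero_lt_top))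
  have hwm : ∀ n, Measurable fun x => cutoff n x * v x := fun n =>
    (continuous_cutoff n).measurable.mul hv
  have hwB : ∀ n x, |cutoff n x * v x| ≤ B := fun n x => by
    rw [abs_mul, abs_of_nonneg (cutoff_nonneg n x)]
    exact (mul_le_of_le_one_left (abs_nonneg _) (cutoff_le_one n x)).trans (hB x)
  have hDn : ∀ n, MemLp (gagliardoQuotient σ (fun x => cutoff (n + n₀) x * v x)) 2
      (volume.prod volume) := fun n =>
    memLp_gagliardoQuotient_of_sub hv (hwm _) hD (hn₀ _ (by omega))
  refine lim v (fun n x => cutoff (n + n₀) x * v x) B hv (fun n => hwm _)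
    (fun n x => hwB _ x) (Eventually.of_forall fun x => ?_) hD hDn
    (hT.comp (tendsto_add_atTop_nat n₀)) (fun n => step _ (hwm _) (hwB _) ?_ ?_ (hDn n))
  · have := ((tendsto_cutoff x).mul_const (v x)).comp (tendsto_add_atTop_nat n₀)
    simpa [Function.comp_def] using this
  · refine hvi.bdd_mul (continuous_cutoff _).aestronglyMeasurable (c := 1)
      (Eventually.of_forall fun x => ?_)
    rw [Real.norm_of_nonneg (cutoff_nonneg _ x)]
    exact cutoff_le_one _ x
  · refine HasCompactSupport.intro
      (isCompact_closedBall 0 (2 * (((n + n₀ : ℕ) : ℝ) + 1))) fun x hx => ?_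
    rw [cutoff_eq_zero, zero_mul]
    simpa using (not_le.1 (fun h => hx (by simpa using h))).le

end

/-! ### The kernel ratio, measurable representatives, and continuity in time -/

section

variable {N : ℕ} {σ : ℝ}

theorem gagliardoQuotient_ae_eq {f g : EuclideanSpace ℝ (Fin N) → ℝ} (h : f =ᵐ[volume] g) :
    gagliardoQuotient σ f =ᵐ[volume.prod volume] gagliardoQuotient σ g := by
  filter_upwards [Measure.quasiMeasurePreserving_fst.ae_eq_comp h,
    Measure.quasiMeasurePreserving_snd.ae_eq_comp h] with p h1 h2
  simp only [Function.comp] at h1 h2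
  simp only [gagliardoQuotient, h1, h2]

theorem gagliardoSq_congr_ae {f g : EuclideanSpace ℝ (Fin N) → ℝ} (h : f =ᵐ[volume] g) :
    gagliardoSq σ f = gagliardoSq σ g := by
  rw [gagliardoSq_eq, gagliardoSq_eq]
  refine lintegral_congr_ae ?_
  filter_upwards [gagliardoQuotient_ae_eq (σ := σ) h] with p hp
  rw [hp]

/-- The ratio of the kernel `J` to the kernel `|x - y|^{-(N+σ)}`. -/
noncomputable def kernelRatio (σ : ℝ) (J : EuclideanSpace ℝ (Fin N) → EuclideanSpace ℝ (Fin N) → ℝ)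
    (p : EuclideanSpace ℝ (Fin N) × EuclideanSpace ℝ (Fin N)) : ℝ :=
  J p.1 p.2 * ‖p.1 - p.2‖ ^ ((N : ℝ) + σ)

theorem energy_eq (J : EuclideanSpace ℝ (Fin N) → EuclideanSpace ℝ (Fin N) → ℝ)
    (f g : EuclideanSpace ℝ (Fin N) → ℝ) :
    energy J f g = (1 / 2) * ∫ p, kernelRatio σ J p * gagliardoQuotient σ f p *
      gagliardoQuotient σ g p ∂(volume.prod volume) := by
  unfold energy
  congr 2; ext p
  rw [mul_assoc (kernelRatio σ J p), gagliardoQuotient_mul, kernelRatio]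
  -- On the diagonal both integrands vanish because the increments do; elsewhere the weights cancel.
  by_cases h : p.1 = p.2
  · simp [h]
  · have hp : 0 < ‖p.1 - p.2‖ ^ ((N : ℝ) + σ) :=
      Real.rpow_pos_of_pos (norm_pos_iff.2 (sub_ne_zero.2 h)) _
    rw [Real.rpow_neg (norm_nonneg _)]
    field_simp

theorem energy_congr_ae (J : EuclideanSpace ℝ (Fin N) → EuclideanSpace ℝ (Fin N) → ℝ)
    {f f' : EuclideanSpace ℝ (Fin N) → ℝ} (g : EuclideanSpace ℝ (Fin N) → ℝ)
    (h : f =ᵐ[volume] f') : energy J f g = energy J f' g := by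
  -- The rewriting of the energy is valid for every order, so any value of `σ` serves.
  rw [energy_eq (σ := 0), energy_eq (σ := 0)]
  congr 1
  refine integral_congr_ae ?_
  filter_upwards [gagliardoQuotient_ae_eq (σ := 0) h] with p hp
  rw [hp]

theorem IsStableLikeKernel.aestronglyMeasurable_ratio
    {J : EuclideanSpace ℝ (Fin N) → EuclideanSpace ℝ (Fin N) → ℝ} (hJ : IsStableLikeKernel σ J) :
    AEStronglyMeasurable (kernelRatio σ J) (volume.prod volume) :=
  hJ.measurable.aestronglyMeasurable.mul
    (by fun_prop : Measurable fun p : EuclideanSpace ℝ (Fin N) × EuclideanSpace ℝ (Fin N) =>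
      ‖p.1 - p.2‖ ^ ((N : ℝ) + σ)).aestronglyMeasurable

/-- The kernel is uncontrolled on the diagonal, but there the ratio is zero since `0 ^ (N + σ) = 0`.
Thus the upper bounds hold everywhere and the positive lower bound only off the diagonal. -/
theorem IsStableLikeKernel.exists_ratio_bounds (hs : 0 < (N : ℝ) + σ)
    {J : EuclideanSpace ℝ (Fin N) → EuclideanSpace ℝ (Fin N) → ℝ} (hJ : IsStableLikeKernel σ J) :
    ∃ Λ : ℝ, 0 < Λ ∧ (∀ p, 0 ≤ kernelRatio σ J p ∧ kernelRatio σ J p ≤ Λ) ∧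
      ∀ p, p.1 ≠ p.2 → 1 / Λ ≤ kernelRatio σ J p := by
  obtain ⟨Λ, hΛ, hb⟩ := hJ.bounds
  have key : ∀ p : EuclideanSpace ℝ (Fin N) × EuclideanSpace ℝ (Fin N), p.1 ≠ p.2 →
      1 / Λ ≤ kernelRatio σ J p ∧ kernelRatio σ J p ≤ Λ := by
    intro p hp
    have hp' : 0 < ‖p.1 - p.2‖ ^ ((N : ℝ) + σ) :=
      Real.rpow_pos_of_pos (norm_pos_iff.2 (sub_ne_zero.2 hp)) _
    obtain ⟨h1, h2⟩ := hb p.1 p.2 hp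
    rw [← one_div_mul_one_div, ← div_eq_mul_one_div, div_le_iff₀ hp'] at h1
    exact ⟨h1, (le_div_iff₀ hp').1 h2⟩
  refine ⟨Λ, hΛ, fun p => ?_, fun p hp => (key p hp).1⟩
  by_cases hp : p.1 = p.2
  · simp [kernelRatio, hp, Real.zero_rpow hs.ne', hΛ.le]
  · exact ⟨(by positivity : (0 : ℝ) ≤ 1 / Λ).trans (key p hp).1, (key p hp).2⟩

/-- The values of `φ` on negative numbers are arbitrary, possibly not measurable; composing with the
positive part restores measurability of `φ(u)`. -/
theorem IsFastDiffusionNonlinearity.continuous_comp_max {φ : ℝ → ℝ}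
    (hφ : IsFastDiffusionNonlinearity φ) : Continuous fun s => φ (max s 0) :=
  hφ.continuousOn.comp_continuous (by fun_prop) fun _ => mem_Ici.2 (le_max_right _ _)

/-- `g` is a measurable, pointwise nonnegative representative of the solution `u`. -/
structure IsRepresentative (φ : ℝ → ℝ) (u g : ℝ → EuclideanSpace ℝ (Fin N) → ℝ) : Prop where
  measurable : Measurable (Function.uncurry g)
  nonneg : ∀ t x, 0 ≤ g t x
  ae_eq : ∀ᵐ t ∂(volume.restrict (Ioi (0 : ℝ))), g t =ᵐ[volume] u t
  measurable_comp : Measurable fun q : ℝ × EuclideanSpace ℝ (Fin N) => φ (g q.1 q.2)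

theorem exists_isRepresentative {φ : ℝ → ℝ} (hφ : IsFastDiffusionNonlinearity φ)
    {u : ℝ → EuclideanSpace ℝ (Fin N) → ℝ}
    (hu : AEStronglyMeasurable (Function.uncurry u) ((volume.restrict (Ioi (0 : ℝ))).prod volume))
    (hu_nonneg : ∀ t : ℝ, 0 ≤ t → ∀ᵐ x ∂volume, 0 ≤ u t x) :
    ∃ g, IsRepresentative φ u g := by
  have hm : Measurable (hu.mk _) := hu.stronglyMeasurable_mk.measurable
  refine ⟨fun t x => max (hu.mk _ (t, x)) 0, ?_, fun t x => le_max_right _ _, ?_, ?_⟩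
  · exact hm.max measurable_const
  · filter_upwards [Measure.ae_ae_of_ae_prod hu.ae_eq_mk, ae_restrict_mem measurableSet_Ioi]
      with t ht ht0
    filter_upwards [ht, hu_nonneg t (le_of_lt ht0)] with x hx hx0
    rw [← hx]
    exact max_eq_left hx0
  · exact hφ.continuous_comp_max.measurable.comp hm

namespace IsRepresentative

variable {φ : ℝ → ℝ} {u g : ℝ → EuclideanSpace ℝ (Fin N) → ℝ}

theorem measurable_slice (hg : IsRepresentative φ u g) (t : ℝ) : Measurable (g t) :=
  hg.measurable.comp measurable_prodMk_left

theorem measurable_comp_slice (hg : IsRepresentative φ u g) (t : ℝ) :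
    Measurable fun x => φ (g t x) :=
  hg.measurable_comp.comp measurable_prodMk_left

theorem measurable_quotient (hg : IsRepresentative φ u g) :
    Measurable fun q : ℝ × EuclideanSpace ℝ (Fin N) × EuclideanSpace ℝ (Fin N) =>
      gagliardoQuotient σ (fun x => φ (g q.1 x)) q.2 := by
  have h1 : Measurable fun q : ℝ × EuclideanSpace ℝ (Fin N) × EuclideanSpace ℝ (Fin N) =>
      φ (g q.1 q.2.1) :=
    hg.measurable_comp.comp (g := fun q : ℝ × EuclideanSpace ℝ (Fin N) => φ (g q.1 q.2))
      (f := fun q : ℝ × EuclideanSpace ℝ (Fin N) × EuclideanSpace ℝ (Fin N) => (q.1, q.2.1))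
      (by fun_prop)
  have h2 : Measurable fun q : ℝ × EuclideanSpace ℝ (Fin N) × EuclideanSpace ℝ (Fin N) =>
      φ (g q.1 q.2.2) :=
    hg.measurable_comp.comp (g := fun q : ℝ × EuclideanSpace ℝ (Fin N) => φ (g q.1 q.2))
      (f := fun q : ℝ × EuclideanSpace ℝ (Fin N) × EuclideanSpace ℝ (Fin N) => (q.1, q.2.2))
      (by fun_prop)
  exact (h1.sub h2).mul (by fun_prop)

theorem memLp_quotient (hg : IsRepresentative φ u g)
    {J : EuclideanSpace ℝ (Fin N) → EuclideanSpace ℝ (Fin N) → ℝ}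
    {u₀ : EuclideanSpace ℝ (Fin N) → ℝ} (hu : IsWeakSolution σ J φ u₀ u) {a b : ℝ} (ha : 0 < a)
    (hab : a < b) :
    MemLp (fun q : ℝ × EuclideanSpace ℝ (Fin N) × EuclideanSpace ℝ (Fin N) =>
      gagliardoQuotient σ (fun x => φ (g q.1 x)) q.2) 2
      ((volume.restrict (Ioc a b)).prod (volume.prod volume)) := by
  rw [memLp_two_iff_lintegral_sq_lt_top hg.measurable_quotient.aestronglyMeasurable,
    lintegral_prod _ (hg.measurable_quotient.pow_const 2).ennreal_ofReal.aemeasurable]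
  refine lt_of_le_of_lt (le_trans (le_of_eq ?_) (lintegral_mono_set Ioc_subset_Icc_self))
    (hu.locallySqIntegrable a b ha hab)
  refine lintegral_congr_ae ?_
  have hsub : Ioc a b ⊆ Ioi (0 : ℝ) := fun x hx => ha.trans hx.1
  filter_upwards [ae_restrict_of_ae_restrict_of_subset hsub hg.ae_eq] with t ht
  rw [← gagliardoSq_eq]
  refine gagliardoSq_congr_ae ?_
  filter_upwards [ht] with x hx
  rw [hx]

end IsRepresentative

/-- Along a curve continuous in `L¹`, integrals of Lipschitz functions are continuous. -/
theorem continuousOn_integral_of_lipschitz {u : ℝ → EuclideanSpace ℝ (Fin N) → ℝ}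
    (huc : ∀ t, 0 ≤ t → Tendsto (fun s => eLpNorm (u s - u t) 1 volume) (𝓝[Ici 0] t) (𝓝 0))
    {F : EuclideanSpace ℝ (Fin N) → ℝ → ℝ} {B : ℝ} (hF : ∀ x a b, |F x a - F x b| ≤ B * |a - b|)
    (hi : ∀ t, 0 ≤ t → Integrable fun x => F x (u t x)) :
    ContinuousOn (fun t => ∫ x, F x (u t x)) (Ici 0) := by
  have hB : 0 ≤ B := by simpa using (abs_nonneg _).trans (hF 0 1 0)
  intro t ht
  refine tendsto_integral_of_L1 _ (hi t ht).aestronglyMeasurable ?_ ?_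
  · filter_upwards [self_mem_nhdsWithin] with s hs using hi s hs
  · have h := ENNReal.Tendsto.const_mul (a := ENNReal.ofReal B) (huc t ht) (Or.inr (by simp))
    rw [mul_zero] at h
    refine tendsto_of_tendsto_of_tendsto_of_le_of_le tendsto_const_nhds h (fun _ => zero_le)
      fun s => ?_
    simp only
    rw [eLpNorm_one_eq_lintegral_enorm, ← lintegral_const_mul' _ _ (by simp)]
    refine lintegral_mono fun x => ?_
    rw [Real.enorm_eq_ofReal_abs, Real.enorm_eq_ofReal_abs, ← ENNReal.ofReal_mul hB]
    exact ENNReal.ofReal_le_ofReal (hF _ _ _)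

theorem lintegral_abs_mul_le_sqrt {α : Type*} [MeasurableSpace α] {μ : Measure α} {f g : α → ℝ}
    (hf : AEMeasurable f μ) (hg : AEMeasurable g μ) :
    ∫⁻ x, ENNReal.ofReal |f x * g x| ∂μ ≤
      (∫⁻ x, ENNReal.ofReal (f x ^ 2) ∂μ) ^ (1 / 2 : ℝ) *
        (∫⁻ x, ENNReal.ofReal (g x ^ 2) ∂μ) ^ (1 / 2 : ℝ) := by
  have h := ENNReal.lintegral_mul_le_Lp_mul_Lq μ Real.HolderConjugate.two_two
    (f := fun x => ENNReal.ofReal |f x|) (g := fun x => ENNReal.ofReal |g x|)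
    (hf.norm.ennreal_ofReal) (hg.norm.ennreal_ofReal)
  have e : ∀ a : ℝ, ENNReal.ofReal |a| ^ (2 : ℝ) = ENNReal.ofReal (a ^ 2) := fun a => by
    rw [ENNReal.rpow_ofNat, ← ENNReal.ofReal_pow (abs_nonneg _), sq_abs]
  simp only [Pi.mul_apply, e] at h
  refine le_trans (le_of_eq ?_) h
  refine lintegral_congr fun x => ?_
  rw [abs_mul, ENNReal.ofReal_mul (abs_nonneg _)]

theorem lintegral_prod_restrict_snd {α : Type*} [MeasurableSpace α] {μ : Measure α} [SFinite μ]
    (s : Set ℝ) {f : α → ℝ≥0∞} (hf : AEMeasurable f μ) :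
    ∫⁻ q, f q.2 ∂((volume.restrict s).prod μ) = volume s * ∫⁻ x, f x ∂μ := by
  have := lintegral_prod_mul (μ := volume.restrict s) (ν := μ) (f := fun _ => 1)
    aemeasurable_const hf
  simpa using this

end

/-! ### The weak formulation integrated in time -/

section

variable {N : ℕ} {σ : ℝ} {φ : ℝ → ℝ} {u g : ℝ → EuclideanSpace ℝ (Fin N) → ℝ}
  {u₀ : EuclideanSpace ℝ (Fin N) → ℝ}
  {J : EuclideanSpace ℝ (Fin N) → EuclideanSpace ℝ (Fin N) → ℝ}

theorem IsRepresentative.integrable_energy_density (hg : IsRepresentative φ u g)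
    (hu : IsWeakSolution σ J φ u₀ u)
    (hJm : AEStronglyMeasurable (kernelRatio σ J) (volume.prod volume)) {Λ : ℝ}
    (hJb : ∀ p, 0 ≤ kernelRatio σ J p ∧ kernelRatio σ J p ≤ Λ)
    {v : EuclideanSpace ℝ (Fin N) → ℝ} (hD : MemLp (gagliardoQuotient σ v) 2 (volume.prod volume))
    {a b : ℝ} (ha : 0 < a) (hab : a < b) :
    Integrable (fun q : ℝ × EuclideanSpace ℝ (Fin N) × EuclideanSpace ℝ (Fin N) =>
      kernelRatio σ J q.2 * gagliardoQuotient σ (fun x => φ (g q.1 x)) q.2 *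
        gagliardoQuotient σ v q.2) ((volume.restrict (Ioc a b)).prod (volume.prod volume)) := by
  have h1 := (hg.memLp_quotient hu ha hab).integrable_mul (hD.comp_snd (volume.restrict (Ioc a b)))
  simp_rw [mul_assoc]
  refine h1.bdd_mul hJm.comp_snd (c := Λ) (Eventually.of_forall fun q => ?_)
  rw [Real.norm_of_nonneg (hJb _).1]
  exact (hJb _).2

/-- The weak formulation integrated in time, for smooth test functions of the space variable. -/
theorem integral_sub_mul_eq_of_smooth (hg : IsRepresentative φ u g)
    (hu : IsWeakSolution σ J φ u₀ u)
    (hJm : AEStronglyMeasurable (kernelRatio σ J) (volume.prod volume)) {Λ : ℝ}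
    (hJb : ∀ p, 0 ≤ kernelRatio σ J p ∧ kernelRatio σ J p ≤ Λ)
    {v : EuclideanSpace ℝ (Fin N) → ℝ} (hv : ContDiff ℝ ∞ v) (hvc : HasCompactSupport v)
    (hD : MemLp (gagliardoQuotient σ v) 2 (volume.prod volume))
    {s t : ℝ} (hs : 0 < s) (hst : s < t) :
    ∫ x, (u t x - u s x) * v x = -((1 / 2) *
      ∫ q : ℝ × EuclideanSpace ℝ (Fin N) × EuclideanSpace ℝ (Fin N),
        kernelRatio σ J q.2 * gagliardoQuotient σ (fun x => φ (g q.1 x)) q.2 *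
        gagliardoQuotient σ v q.2 ∂((volume.restrict (Ioc s t)).prod (volume.prod volume))) := by
  obtain ⟨B, hB⟩ := hv.continuous.bounded_above_of_compact_support hvc
  have hint : ∀ r, 0 ≤ r → Integrable fun x => u r x * v x := fun r hr =>
    (memLp_one_iff_integrable.1 (hu.memLp_one r hr)).mul_bdd hv.continuous.aestronglyMeasurable
      (Eventually.of_forall hB)
  have hU : ContinuousOn (fun t => ∫ x, u t x * v x) (Ici 0) :=
    continuousOn_integral_of_lipschitz hu.continuous_L1 (F := fun x a => a * v x) (B := B)
      (fun x a b => by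
        rw [← sub_mul, abs_mul, mul_comm]
        exact mul_le_mul_of_nonneg_right (hB x) (abs_nonneg _)) hint
  have hE := fun {a b : ℝ} (ha : 0 < a) (hab : a < b) =>
    hg.integrable_energy_density hu hJm hJb hD ha hab
  have key := sub_eq_neg_setIntegral_of_weak_deriv (U := fun t => ∫ x, u t x * v x)
    (g := fun r => (1 / 2) * ∫ p, kernelRatio σ J p *
      gagliardoQuotient σ (fun x => φ (g r x)) p * gagliardoQuotient σ v p
        ∂(volume.prod volume)) (hU.mono Ioi_subset_Ici_self)
    (fun a b ha => by
      rcases lt_or_ge a b with hab | hab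
      · exact ((hE ha hab).integral_prod_left).const_mul _
      · simp [Ioc_eq_empty_of_le hab]) ?_ hs hst
  · simp_rw [sub_mul]
    rw [integral_sub (hint t (hs.trans hst).le) (hint s hs.le), integral_prod _ (hE hs hst),
      ← integral_const_mul]
    exact key
  · intro η hη hηc hηs
    -- Tensor products `v(x) η(t)` reduce the equation to a distributional identity in time for `t ↦
    -- ∫ u(t) v`.
    have heq := hu.equation (fun q => v q.1 * η q.2)
      ((hv.comp contDiff_fst).mul (hη.comp contDiff_snd)) ?_ ?_
    · rw [sub_eq_zero] at heq
      convert! heq using 1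
      · refine setIntegral_congr_fun measurableSet_Ioi fun r _ => ?_
        simp only [deriv_const_mul_field', ← mul_assoc]
        rw [integral_mul_const]
      · refine setIntegral_congr_ae measurableSet_Ioi ?_
        filter_upwards [(ae_restrict_iff' measurableSet_Ioi).1 hg.ae_eq] with r hr hr0
        have hr1 : (fun x => φ (u r x)) =ᵐ[volume] fun x => φ (g r x) := by
          filter_upwards [hr hr0] with x hx
          rw [hx]
        rw [energy_congr_ae J _ hr1, energy_eq (σ := σ)]
        have : ∀ p, gagliardoQuotient σ (fun x => v x * η r) p = gagliardoQuotient σ v p * η r :=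
          fun p => by simp only [gagliardoQuotient]; ring
        simp_rw [this, ← mul_assoc]
        rw [integral_mul_const]
        ring
    · refine HasCompactSupport.intro (hvc.isCompact.prod hηc.isCompact) fun q hq => ?_
      rw [mem_prod, not_and_or] at hq
      rcases hq with h | h
      · simp [image_eq_zero_of_notMem_tsupport h]
      · simp [image_eq_zero_of_notMem_tsupport h]
    · refine (closure_minimal (t := univ ×ˢ tsupport η) ?_
        (isClosed_univ.prod (isClosed_tsupport _))).trans (prod_mono_right hηs)
      intro q hq
      refine ⟨mem_univ _, ?_⟩
      by_contra h
      exact hq (by simp [image_eq_zero_of_notMem_tsupport h])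

/-- The weak formulation integrated in time, for bounded integrable test functions with finite
Gagliardo seminorm. -/
theorem integral_sub_mul_eq (hN : N ≠ 0) (hσ : σ ∈ Ioo (0 : ℝ) 2) (hg : IsRepresentative φ u g)
    (hu : IsWeakSolution σ J φ u₀ u)
    (hJm : AEStronglyMeasurable (kernelRatio σ J) (volume.prod volume)) {Λ : ℝ}
    (hJb : ∀ p, 0 ≤ kernelRatio σ J p ∧ kernelRatio σ J p ≤ Λ)
    {s t : ℝ} (hs : 0 < s) (hst : s < t)
    {v : EuclideanSpace ℝ (Fin N) → ℝ} (hv : Measurable v) {B : ℝ} (hB : ∀ x, |v x| ≤ B)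
    (hvi : Integrable v) (hD : MemLp (gagliardoQuotient σ v) 2 (volume.prod volume)) :
    ∫ x, (u t x - u s x) * v x = -((1 / 2) *
      ∫ q : ℝ × EuclideanSpace ℝ (Fin N) × EuclideanSpace ℝ (Fin N),
        kernelRatio σ J q.2 * gagliardoQuotient σ (fun x => φ (g q.1 x)) q.2 *
        gagliardoQuotient σ v q.2 ∂((volume.restrict (Ioc s t)).prod (volume.prod volume))) := by
  refine induction_on_smooth (σ := σ) hN hσ (P := fun v => ∫ x, (u t x - u s x) * v x =
    -((1 / 2) * ∫ q : ℝ × EuclideanSpace ℝ (Fin N) × EuclideanSpace ℝ (Fin N),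
        kernelRatio σ J q.2 * gagliardoQuotient σ (fun x => φ (g q.1 x)) q.2 *
        gagliardoQuotient σ v q.2 ∂((volume.restrict (Ioc s t)).prod (volume.prod volume))))
    (fun v hv hvc hD => integral_sub_mul_eq_of_smooth hg hu hJm hJb hv hvc hD hs hst) ?_
    hv hB hvi hD
  clear! v B
  intro v w B hv hw hB hlim hD hDw hT hP
  have hP1 := hg.memLp_quotient hu hs hst
  have hΛ : 0 ≤ Λ := (hJb 0).1.trans (hJb 0).2
  have hui : Integrable fun x => u t x - u s x :=
    (memLp_one_iff_integrable.1 (hu.memLp_one t (hs.trans hst).le)).sub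
      (memLp_one_iff_integrable.1 (hu.memLp_one s hs.le))
  have hL : Tendsto (fun n => ∫ x, (u t x - u s x) * w n x) atTop
      (𝓝 (∫ x, (u t x - u s x) * v x)) := by
    refine tendsto_integral_of_dominated_convergence (fun x => ‖u t x - u s x‖ * B)
      (fun n => hui.aestronglyMeasurable.mul (hw n).aestronglyMeasurable) (hui.norm.mul_const B)
      (fun n => Eventually.of_forall fun x => ?_) ?_
    · rw [norm_mul]
      exact mul_le_mul_of_nonneg_left (hB n x) (norm_nonneg _)
    · filter_upwards [hlim] with x hx using hx.const_mul _
  have hR : Tendsto (fun n => ∫ q : ℝ × EuclideanSpace ℝ (Fin N) × EuclideanSpace ℝ (Fin N),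
      kernelRatio σ J q.2 * gagliardoQuotient σ (fun x => φ (g q.1 x)) q.2 *
        gagliardoQuotient σ (w n) q.2 ∂((volume.restrict (Ioc s t)).prod (volume.prod volume)))
      atTop (𝓝 (∫ q : ℝ × EuclideanSpace ℝ (Fin N) × EuclideanSpace ℝ (Fin N),
      kernelRatio σ J q.2 * gagliardoQuotient σ (fun x => φ (g q.1 x)) q.2 *
        gagliardoQuotient σ v q.2 ∂((volume.restrict (Ioc s t)).prod (volume.prod volume)))) := by
    -- Cauchy–Schwarz on `(s, t] × ℝ^N × ℝ^N`. The difference of quotients does not depend on time,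
    -- so its squared norm only acquires the factor `t - s`.
    refine tendsto_integral_of_L1 _
      (hg.integrable_energy_density hu hJm hJb hD hs hst).aestronglyMeasurable
      (Eventually.of_forall fun n => hg.integrable_energy_density hu hJm hJb (hDw n) hs hst) ?_
    set M := ∫⁻ q : ℝ × EuclideanSpace ℝ (Fin N) × EuclideanSpace ℝ (Fin N),
      ENNReal.ofReal (gagliardoQuotient σ (fun x => φ (g q.1 x)) q.2 ^ 2)
        ∂((volume.restrict (Ioc s t)).prod (volume.prod volume)) with hM
    have hMt : M < ⊤ := (memLp_two_iff_lintegral_sq_lt_top hP1.1).1 hP1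
    have hT2 : Tendsto (fun n => ENNReal.ofReal Λ * (M ^ (1 / 2 : ℝ) *
        (volume (Ioc s t) * ∫⁻ p, ENNReal.ofReal ((gagliardoQuotient σ (w n) p -
        gagliardoQuotient σ v p) ^ 2) ∂(volume.prod volume)) ^ (1 / 2 : ℝ))) atTop (𝓝 0) := by
      have h1 := ENNReal.Tendsto.const_mul (a := volume (Ioc s t)) hT (Or.inr (by simp))
      have h2 := ((ENNReal.continuous_rpow_const (y := (1 / 2 : ℝ))).tendsto _).comp h1
      have h3 := ENNReal.Tendsto.const_mul (a := M ^ (1 / 2 : ℝ)) h2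
        (Or.inr (ENNReal.rpow_ne_top_of_nonneg (by norm_num) hMt.ne))
      have h4 := ENNReal.Tendsto.const_mul (a := ENNReal.ofReal Λ) h3 (Or.inr (by simp))
      simpa [Function.comp_def] using h4
    refine tendsto_of_tendsto_of_tendsto_of_le_of_le tendsto_const_nhds hT2 (fun _ => zero_le)
      fun n => ?_
    have hm : Measurable fun p => gagliardoQuotient σ (w n) p - gagliardoQuotient σ v p :=
      (measurable_gagliardoQuotient σ (hw n)).sub (measurable_gagliardoQuotient σ hv)
    have hCS := lintegral_abs_mul_le_sqrt
      (μ := (volume.restrict (Ioc s t)).prod ((volume : Measure (EuclideanSpace ℝ (Fin N))).prod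
        (volume : Measure (EuclideanSpace ℝ (Fin N)))))
      (hg.measurable_quotient (σ := σ)).aemeasurable (hm.comp measurable_snd).aemeasurable
    simp only [Function.comp] at hCS
    rw [lintegral_prod_restrict_snd (Ioc s t)
      (f := fun p => ENNReal.ofReal ((gagliardoQuotient σ (w n) p - gagliardoQuotient σ v p) ^ 2))
      (hm.pow_const 2).ennreal_ofReal.aemeasurable] at hCS
    refine le_trans ?_ (mul_le_mul_right hCS _)
    rw [← lintegral_const_mul' _ _ (by simp)]
    refine lintegral_mono fun q => ?_
    rw [← mul_sub, Real.enorm_eq_ofReal_abs, ← ENNReal.ofReal_mul hΛ, mul_assoc, abs_mul,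
      abs_of_nonneg (hJb _).1]
    exact ENNReal.ofReal_le_ofReal (mul_le_mul_of_nonneg_right (hJb _).2 (abs_nonneg _))
  exact tendsto_nhds_unique hL (((hR.const_mul (1 / 2)).neg).congr fun n => (hP n).symm)

end

/-! ### Averaged smallness of time increments -/

theorem setLIntegral_Ioc_sub (F : ℝ → ℝ≥0∞) (t h : ℝ) :
    ∫⁻ r in Ioc (t - h) t, F r = ∫⁻ τ in Ico 0 h, F (t - τ) := by
  rw [← lintegral_indicator measurableSet_Ioc, ← lintegral_indicator measurableSet_Ico,
    ← lintegral_sub_left_eq_self (μ := (volume : Measure ℝ)) _ t]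
  refine lintegral_congr fun τ => ?_
  by_cases hτ : τ ∈ Ico 0 h
  · rw [indicator_of_mem hτ, indicator_of_mem]
    exact ⟨by linarith [hτ.2], by linarith [hτ.1]⟩
  · rw [indicator_of_notMem hτ, indicator_of_notMem]
    exact fun hc => hτ ⟨by linarith [hc.2], by linarith [hc.1]⟩

/-- Time increments of a function that is locally square integrable in time are small on average
when paired with a square integrable function. -/
theorem exists_forall_lintegral_time_increment_le {N : ℕ}
    {P Q : ℝ × EuclideanSpace ℝ (Fin N) × EuclideanSpace ℝ (Fin N) → ℝ}
    (hP : Measurable P) (hQ : Measurable Q) {a' a b : ℝ} (haa : a' < a)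
    (hP2 : MemLp P 2 ((volume.restrict (Ioc a' b)).prod (volume.prod volume)))
    (hQ2 : MemLp Q 2 ((volume.restrict (Ioc a b)).prod (volume.prod volume)))
    {η : ℝ} (hη : 0 < η) :
    ∃ δ > 0, ∀ h, 0 < h → h < δ →
      ∫⁻ t in Ioc a b, ∫⁻ r in Ioc (t - h) t, (∫⁻ p, ENNReal.ofReal
        |(P (r, p) - P (t, p)) * Q (t, p)| ∂(volume.prod volume)) ≤ ENNReal.ofReal (η * h) := by
  set ν : Measure (EuclideanSpace ℝ (Fin N) × EuclideanSpace ℝ (Fin N)) :=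
    volume.prod volume with hν
  -- Extension by zero to all times, so that time shifts preserve the measure and are continuous in
  -- `L²`.
  let P1 : ℝ × EuclideanSpace ℝ (Fin N) × EuclideanSpace ℝ (Fin N) → ℝ :=
    (Ioc a' b ×ˢ univ).indicator P
  have hS : MeasurableSet (Ioc a' b ×ˢ
      (univ : Set (EuclideanSpace ℝ (Fin N) × EuclideanSpace ℝ (Fin N)))) :=
    measurableSet_Ioc.prod MeasurableSet.univ
  have hP1m : Measurable P1 := hP.indicator hS
  have hP1 : MemLp P1 2 ((volume : Measure ℝ).prod ν) := by
    rw [memLp_indicator_iff_restrict hS, ← Measure.prod_restrict, Measure.restrict_univ]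
    exact hP2
  let T : ℝ → ℝ × EuclideanSpace ℝ (Fin N) × EuclideanSpace ℝ (Fin N) →
    ℝ × EuclideanSpace ℝ (Fin N) × EuclideanSpace ℝ (Fin N) := fun τ q => (q.1 - τ, q.2)
  have hTm : ∀ τ, MeasurePreserving (T τ) ((volume : Measure ℝ).prod ν)
      ((volume : Measure ℝ).prod ν) := fun τ =>
    (measurePreserving_sub_right volume τ).prod (MeasurePreserving.id ν)
  have hT := tendsto_lintegral_comp_sub_sq T (by fun_prop) hTm 0 (by simp [T]) hP1
  set M := ∫⁻ q, ENNReal.ofReal (Q q ^ 2) ∂((volume.restrict (Ioc a b)).prod ν) with hM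
  have hMt : M < ⊤ := (memLp_two_iff_lintegral_sq_lt_top hQ2.1).1 hQ2
  have hT2 : Tendsto (fun τ => (∫⁻ q, ENNReal.ofReal ((P1 (T τ q) - P1 q) ^ 2)
      ∂((volume : Measure ℝ).prod ν)) ^ (1 / 2 : ℝ) * M ^ (1 / 2 : ℝ)) (𝓝 0) (𝓝 0) := by
    have h2 := ((ENNReal.continuous_rpow_const (y := (1 / 2 : ℝ))).tendsto _).comp hT
    have h3 := ENNReal.Tendsto.mul_const (b := M ^ (1 / 2 : ℝ)) h2
      (Or.inr (ENNReal.rpow_ne_top_of_nonneg (by norm_num) hMt.ne))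
    simpa [Function.comp_def] using h3
  obtain ⟨δ, hδ, hδ'⟩ := Metric.eventually_nhds_iff_ball.1
    ((ENNReal.tendsto_nhds_zero.1 hT2) (ENNReal.ofReal η) (ENNReal.ofReal_pos.2 hη))
  -- The bound `h < a - a'` keeps `t - τ` in `(a', b]`, where the extension agrees with `P`.
  refine ⟨min δ (a - a'), lt_min hδ (sub_pos.2 haa), fun h h0 hh => ?_⟩
  have hhδ := hh.trans_le (min_le_left _ _)
  have hha := hh.trans_le (min_le_right _ _)
  simp_rw [setLIntegral_Ioc_sub]
  have hFm : Measurable fun q : (ℝ × ℝ) × EuclideanSpace ℝ (Fin N) × EuclideanSpace ℝ (Fin N) =>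
      ENNReal.ofReal |(P (q.1.1 - q.1.2, q.2) - P (q.1.1, q.2)) * Q (q.1.1, q.2)| := by
    have m1 : Measurable fun q : (ℝ × ℝ) × EuclideanSpace ℝ (Fin N) × EuclideanSpace ℝ (Fin N) =>
      P (q.1.1 - q.1.2, q.2) := hP.comp (by fun_prop)
    have m2 : Measurable fun q : (ℝ × ℝ) × EuclideanSpace ℝ (Fin N) × EuclideanSpace ℝ (Fin N) =>
      P (q.1.1, q.2) := hP.comp (by fun_prop)
    have m3 : Measurable fun q : (ℝ × ℝ) × EuclideanSpace ℝ (Fin N) × EuclideanSpace ℝ (Fin N) =>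
      Q (q.1.1, q.2) := hQ.comp (by fun_prop)
    exact ((m1.sub m2).mul m3).norm.ennreal_ofReal
  rw [lintegral_lintegral_swap (hFm.lintegral_prod_right').aemeasurable]
  calc ∫⁻ τ in Ico 0 h, ∫⁻ t in Ioc a b, ∫⁻ p, ENNReal.ofReal
        |(P (t - τ, p) - P (t, p)) * Q (t, p)| ∂ν
      ≤ ∫⁻ τ in Ico 0 h, ENNReal.ofReal η := by
        refine setLIntegral_mono measurable_const fun τ hτ => ?_
        refine le_trans ?_ (hδ' τ (by
          rw [mem_ball_zero_iff, Real.norm_of_nonneg hτ.1]; exact hτ.2.trans hhδ))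
        have m1 : Measurable fun q : ℝ × EuclideanSpace ℝ (Fin N) × EuclideanSpace ℝ (Fin N) =>
          P1 (T τ q) - P1 q := (hP1m.comp (hTm τ).measurable).sub hP1m
        have m2 : Measurable fun q : ℝ × EuclideanSpace ℝ (Fin N) × EuclideanSpace ℝ (Fin N) =>
          ENNReal.ofReal |(P1 (T τ q) - P1 q) * Q q| := (m1.mul hQ).norm.ennreal_ofReal
        calc ∫⁻ t in Ioc a b, ∫⁻ p, ENNReal.ofReal |(P (t - τ, p) - P (t, p)) * Q (t, p)| ∂ν
            = ∫⁻ t in Ioc a b, ∫⁻ p, ENNReal.ofReal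
                |(P1 (T τ (t, p)) - P1 (t, p)) * Q (t, p)| ∂ν := by
              refine setLIntegral_congr_fun measurableSet_Ioc fun t ht => ?_
              have t1 : t ∈ Ioc a' b := ⟨haa.trans ht.1, ht.2⟩
              have t2 : t - τ ∈ Ioc a' b := ⟨by linarith [ht.1, hτ.2], by linarith [ht.2, hτ.1]⟩
              refine lintegral_congr fun p => ?_
              simp only [P1, T, indicator_of_mem (show (t, p) ∈ Ioc a' b ×ˢ univ from ⟨t1, trivial⟩),
                indicator_of_mem (show (t - τ, p) ∈ Ioc a' b ×ˢ univ from ⟨t2, trivial⟩)]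
          _ = ∫⁻ q, ENNReal.ofReal |(P1 (T τ q) - P1 q) * Q q|
                ∂((volume.restrict (Ioc a b)).prod ν) :=
              (lintegral_prod _ m2.aemeasurable).symm
          _ ≤ (∫⁻ q, ENNReal.ofReal ((P1 (T τ q) - P1 q) ^ 2)
                ∂((volume.restrict (Ioc a b)).prod ν)) ^ (1 / 2 : ℝ) * M ^ (1 / 2 : ℝ) :=
              lintegral_abs_mul_le_sqrt m1.aemeasurable hQ.aemeasurable
          _ ≤ _ := by
              refine mul_le_mul_left (ENNReal.rpow_le_rpow (lintegral_mono' ?_ le_rfl)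
                (by norm_num)) _
              exact Measure.prod_mono Measure.restrict_le_self le_rfl
    _ = ENNReal.ofReal (η * h) := by
        rw [setLIntegral_const, Real.volume_Ico, sub_zero, ENNReal.ofReal_mul hη.le]

/-! ### Truncations, their entropies, and the one-step entropy inequality -/

section

/-- A bounded nondecreasing truncation, vanishing near `0` and Lipschitz with respect to `φ`. -/
structure IsTruncation (φ θ : ℝ → ℝ) (B L ε : ℝ) : Prop where
  continuous : Continuous θ
  monotone : Monotone θ
  nonneg : ∀ s, 0 ≤ θ s
  le : ∀ s, θ s ≤ B
  eps_pos : 0 < ε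
  eq_zero : ∀ s, s ≤ ε → θ s = 0
  lipschitz : ∀ a b, 0 ≤ a → 0 ≤ b → |θ a - θ b| ≤ L * |φ a - φ b|
  mul_nonneg : ∀ a b, 0 ≤ a → 0 ≤ b → 0 ≤ (φ a - φ b) * (θ a - θ b)

/-- The primitive of `θ` vanishing at `0`. -/
noncomputable def entropy (θ : ℝ → ℝ) (s : ℝ) : ℝ := ∫ x in (0 : ℝ)..s, θ x

namespace IsTruncation

variable {φ θ : ℝ → ℝ} {B L ε : ℝ}

theorem entropy_sub (hθ : IsTruncation φ θ B L ε) (a b : ℝ) :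
    entropy θ a - entropy θ b = ∫ x in b..a, θ x :=
  intervalIntegral.integral_interval_sub_left (hθ.continuous.intervalIntegrable _ _)
    (hθ.continuous.intervalIntegrable _ _)

/-- Convexity of the entropy, whose derivative `θ` is nondecreasing. The tangent is taken at the
first point, which will be the later time. -/
theorem entropy_sub_le (hθ : IsTruncation φ θ B L ε) (a b : ℝ) :
    entropy θ a - entropy θ b ≤ (a - b) * θ a := by
  rw [hθ.entropy_sub]
  rcases le_total b a with h | h
  · have := intervalIntegral.integral_mono_on h
      (hθ.continuous.intervalIntegrable (μ := volume) _ _)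
      (intervalIntegrable_const (c := θ a) (μ := volume)) fun x hx => hθ.monotone hx.2
    simpa using this
  · have := intervalIntegral.integral_mono_on h (intervalIntegrable_const (c := θ a))
      (hθ.continuous.intervalIntegrable (μ := volume) _ _) fun x hx => hθ.monotone hx.1
    rw [intervalIntegral.integral_symm]
    simp only [intervalIntegral.integral_const, smul_eq_mul] at this
    linarith

theorem bound_nonneg (hθ : IsTruncation φ θ B L ε) : 0 ≤ B := (hθ.nonneg 0).trans (hθ.le 0)

theorem abs_entropy_sub_le (hθ : IsTruncation φ θ B L ε) (a b : ℝ) :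
    |entropy θ a - entropy θ b| ≤ B * |a - b| := by
  rw [hθ.entropy_sub, ← Real.norm_eq_abs]
  refine intervalIntegral.norm_integral_le_of_norm_le_const fun x _ => ?_
  rw [Real.norm_of_nonneg (hθ.nonneg x)]
  exact hθ.le x

theorem entropy_nonneg (hθ : IsTruncation φ θ B L ε) {s : ℝ} (hs : 0 ≤ s) : 0 ≤ entropy θ s :=
  intervalIntegral.integral_nonneg hs fun x _ => hθ.nonneg x

theorem continuous_entropy (hθ : IsTruncation φ θ B L ε) : Continuous (entropy θ) :=
  intervalIntegral.continuous_primitive (fun a b => hθ.continuous.intervalIntegrable a b) 0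

theorem integrable_entropy {α : Type*} [MeasurableSpace α] {μ : Measure α}
    (hθ : IsTruncation φ θ B L ε) {f : α → ℝ} (hf : Integrable f μ) :
    Integrable (fun x => entropy θ (f x)) μ := by
  refine (hf.norm.const_mul B).mono' (hθ.continuous_entropy.comp_aestronglyMeasurable hf.1)
    (Eventually.of_forall fun x => ?_)
  have := hθ.abs_entropy_sub_le (f x) 0
  simpa [entropy] using this

/-- This is where vanishing near zero is used: it makes `θ(u)` integrable, hence an admissible test
function. -/
theorem le_mul (hθ : IsTruncation φ θ B L ε) {s : ℝ} (hs : 0 ≤ s) : θ s ≤ B / ε * s := by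
  have hB := hθ.bound_nonneg
  have hε := hθ.eps_pos
  rcases le_total s ε with h | h
  · rw [hθ.eq_zero s h]; positivity
  · refine (hθ.le s).trans ?_
    rw [div_mul_eq_mul_div, le_div_iff₀ hε]
    exact mul_le_mul_of_nonneg_left h hB

theorem integrable_comp {α : Type*} [MeasurableSpace α] {μ : Measure α}
    (hθ : IsTruncation φ θ B L ε) {f : α → ℝ} (hf : Integrable f μ) (hf0 : ∀ x, 0 ≤ f x) :
    Integrable (fun x => θ (f x)) μ := by
  refine (hf.const_mul (B / ε)).mono' (hθ.continuous.comp_aestronglyMeasurable hf.1)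
    (Eventually.of_forall fun x => ?_)
  rw [Real.norm_of_nonneg (hθ.nonneg _)]
  exact hθ.le_mul (hf0 x)

variable {N : ℕ} {σ : ℝ}

theorem abs_gagliardoQuotient_le (hθ : IsTruncation φ θ B L ε)
    {f : EuclideanSpace ℝ (Fin N) → ℝ} (hf : ∀ x, 0 ≤ f x)
    (p : EuclideanSpace ℝ (Fin N) × EuclideanSpace ℝ (Fin N)) :
    |gagliardoQuotient σ (fun x => θ (f x)) p| ≤
      L * |gagliardoQuotient σ (fun x => φ (f x)) p| := by
  simp only [gagliardoQuotient, abs_mul, ← mul_assoc]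
  exact mul_le_mul_of_nonneg_right (hθ.lipschitz _ _ (hf _) (hf _)) (abs_nonneg _)

theorem gagliardoQuotient_mul_nonneg (hθ : IsTruncation φ θ B L ε)
    {f : EuclideanSpace ℝ (Fin N) → ℝ} (hf : ∀ x, 0 ≤ f x)
    (p : EuclideanSpace ℝ (Fin N) × EuclideanSpace ℝ (Fin N)) :
    0 ≤ gagliardoQuotient σ (fun x => φ (f x)) p * gagliardoQuotient σ (fun x => θ (f x)) p := by
  rw [gagliardoQuotient_mul]
  exact _root_.mul_nonneg (hθ.mul_nonneg _ _ (hf _) (hf _)) (Real.rpow_nonneg (norm_nonneg _) _)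

end IsTruncation

/-- The dissipation of the entropy with derivative `θ` at the state `f`. -/
noncomputable def dissipation {N : ℕ} (σ : ℝ)
    (J : EuclideanSpace ℝ (Fin N) → EuclideanSpace ℝ (Fin N) → ℝ) (φ θ : ℝ → ℝ)
    (f : EuclideanSpace ℝ (Fin N) → ℝ) : ℝ≥0∞ :=
  ∫⁻ p, ENNReal.ofReal (kernelRatio σ J p * gagliardoQuotient σ (fun x => φ (f x)) p *
    gagliardoQuotient σ (fun x => θ (f x)) p) ∂(volume.prod volume)

theorem ofReal_integral_le_lintegral {α : Type*} [MeasurableSpace α] {μ : Measure α} {f : α → ℝ}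
    (hf : Integrable f μ) : ENNReal.ofReal (∫ x, f x ∂μ) ≤ ∫⁻ x, ENNReal.ofReal |f x| ∂μ := by
  rw [← ofReal_integral_eq_lintegral_ofReal hf.abs (Eventually.of_forall fun x => abs_nonneg _)]
  exact ENNReal.ofReal_le_ofReal (integral_mono hf hf.abs fun x => le_abs_self _)

variable {N : ℕ} {σ : ℝ} {φ θ : ℝ → ℝ} {B L ε : ℝ} {u g : ℝ → EuclideanSpace ℝ (Fin N) → ℝ}
  {u₀ : EuclideanSpace ℝ (Fin N) → ℝ}
  {J : EuclideanSpace ℝ (Fin N) → EuclideanSpace ℝ (Fin N) → ℝ}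

/-- An implicit Euler step: the equation on `(t - h, t)` is tested with `θ(u(t))`, convexity bounds
the entropy increment, and `φ(u(r))` is replaced by `φ(u(t))` at the cost of the last term. The form
in `[0, ∞]` allows integration in `t` before anything is known to be finite. -/
theorem entropy_increment_le (hN : N ≠ 0) (hσ : σ ∈ Ioo (0 : ℝ) 2)
    (hg : IsRepresentative φ u g) (hu : IsWeakSolution σ J φ u₀ u)
    (hu_nonneg : ∀ t : ℝ, 0 ≤ t → ∀ᵐ x ∂volume, 0 ≤ u t x)
    (hJm : AEStronglyMeasurable (kernelRatio σ J) (volume.prod volume)) {Λ : ℝ}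
    (hJb : ∀ p, 0 ≤ kernelRatio σ J p ∧ kernelRatio σ J p ≤ Λ) (hθ : IsTruncation φ θ B L ε)
    {t h : ℝ} (h0 : 0 < h) (hht : h < t) (hgt : g t =ᵐ[volume] u t)
    (hw : gagliardoSq σ (fun x => φ (u t x)) < ⊤) :
    ENNReal.ofReal (∫ x, entropy θ (u t x)) +
        ENNReal.ofReal (h / 2) * dissipation σ J φ θ (g t) ≤
      ENNReal.ofReal (∫ x, entropy θ (u (t - h) x)) + ENNReal.ofReal (Λ / 2) *
        ∫⁻ r in Ioc (t - h) t, (∫⁻ p, ENNReal.ofReal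
          |(gagliardoQuotient σ (fun x => φ (g r x)) p -
              gagliardoQuotient σ (fun x => φ (g t x)) p) *
            gagliardoQuotient σ (fun x => θ (g t x)) p| ∂(volume.prod volume)) := by
  have hth : 0 < t - h := sub_pos.2 hht
  have ht : 0 < t := h0.trans hht
  have hlt : t - h < t := sub_lt_self t h0
  have hΛ : 0 ≤ Λ := (hJb 0).1.trans (hJb 0).2
  have hui : ∀ r, 0 ≤ r → Integrable (u r) := fun r hr =>
    memLp_one_iff_integrable.1 (hu.memLp_one r hr)
  have hgi : Integrable (g t) := (hui t ht.le).congr hgt.symm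
  have hgm := hg.measurable_slice t
  set v : EuclideanSpace ℝ (Fin N) → ℝ := fun x => θ (g t x) with hv
  set w : EuclideanSpace ℝ (Fin N) → ℝ := fun x => φ (g t x) with hw'
  have hvm : Measurable v := hθ.continuous.measurable.comp hgm
  have hwm : Measurable w := hg.measurable_comp_slice t
  have hvi : Integrable v := hθ.integrable_comp hgi (hg.nonneg t)
  have hvB : ∀ x, |v x| ≤ B := fun x => by
    rw [abs_of_nonneg (hθ.nonneg _)]; exact hθ.le _
  have hDw : MemLp (gagliardoQuotient σ w) 2 (volume.prod volume) := by
    rw [memLp_two_iff_lintegral_sq_lt_top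
      (measurable_gagliardoQuotient σ hwm).aestronglyMeasurable, ← gagliardoSq_eq]
    refine lt_of_le_of_lt (le_of_eq (gagliardoSq_congr_ae ?_)) hw
    filter_upwards [hgt] with x hx
    simp only [hw', hx]
  have hDv : MemLp (gagliardoQuotient σ v) 2 (volume.prod volume) :=
    hDw.of_le_mul (measurable_gagliardoQuotient σ hvm).aestronglyMeasurable
      (Eventually.of_forall fun p => hθ.abs_gagliardoQuotient_le (hg.nonneg t) p)
  have hid := integral_sub_mul_eq hN hσ hg hu hJm hJb hth hlt hvm hvB hvi hDv
  set ν := (volume.restrict (Ioc (t - h) t)).prod ((volume :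
    Measure (EuclideanSpace ℝ (Fin N))).prod (volume : Measure (EuclideanSpace ℝ (Fin N)))) with hν
  have hI1 := hg.integrable_energy_density hu hJm hJb hDv hth hlt
  have hI0 : Integrable (fun p => kernelRatio σ J p * gagliardoQuotient σ w p *
      gagliardoQuotient σ v p) (volume.prod volume) := by
    simp_rw [mul_assoc]
    refine (hDw.integrable_mul hDv).bdd_mul hJm (c := Λ) (Eventually.of_forall fun q => ?_)
    rw [Real.norm_of_nonneg (hJb _).1]
    exact (hJb _).2
  have hI2 : Integrable (fun q : ℝ × EuclideanSpace ℝ (Fin N) × EuclideanSpace ℝ (Fin N) =>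
      kernelRatio σ J q.2 * gagliardoQuotient σ w q.2 * gagliardoQuotient σ v q.2) ν :=
    hI0.comp_snd _
  have hI2' : ∫ q, kernelRatio σ J q.2 * gagliardoQuotient σ w q.2 *
      gagliardoQuotient σ v q.2 ∂ν = h * ∫ p, kernelRatio σ J p * gagliardoQuotient σ w p *
        gagliardoQuotient σ v p ∂(volume.prod volume) := by
    rw [integral_prod _ hI2]
    simp [h0.le]
  have hd0 : ∀ p, 0 ≤ kernelRatio σ J p * gagliardoQuotient σ w p * gagliardoQuotient σ v p :=
    fun p => by
      rw [mul_assoc]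
      exact mul_nonneg (hJb p).1 (hθ.gagliardoQuotient_mul_nonneg (hg.nonneg t) p)
  have hdis : dissipation σ J φ θ (g t) = ENNReal.ofReal (∫ p, kernelRatio σ J p *
      gagliardoQuotient σ w p * gagliardoQuotient σ v p ∂(volume.prod volume)) :=
    (ofReal_integral_eq_lintegral_ofReal hI0 (Eventually.of_forall hd0)).symm
  have hconv : (∫ x, entropy θ (u t x)) - ∫ x, entropy θ (u (t - h) x) ≤
      ∫ x, (u t x - u (t - h) x) * v x := by
    rw [← integral_sub (hθ.integrable_entropy (hui t ht.le))
      (hθ.integrable_entropy (hui _ hth.le))]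
    refine integral_mono_ae ((hθ.integrable_entropy (hui t ht.le)).sub
      (hθ.integrable_entropy (hui _ hth.le))) (((hui t ht.le).sub (hui _ hth.le)).mul_bdd
      hvm.aestronglyMeasurable (Eventually.of_forall hvB)) ?_
    filter_upwards [hgt] with x hx
    simp only [hv, hx]
    exact hθ.entropy_sub_le _ _
  set E := ∫ p, kernelRatio σ J p * gagliardoQuotient σ w p * gagliardoQuotient σ v p
    ∂(volume.prod volume) with hE
  have hE0 : 0 ≤ E := integral_nonneg hd0
  -- The error made by freezing the energy density at time `t`.
  let R : ℝ × EuclideanSpace ℝ (Fin N) × EuclideanSpace ℝ (Fin N) → ℝ := fun q =>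
    kernelRatio σ J q.2 * gagliardoQuotient σ w q.2 * gagliardoQuotient σ v q.2 -
      kernelRatio σ J q.2 * gagliardoQuotient σ (fun x => φ (g q.1 x)) q.2 *
        gagliardoQuotient σ v q.2
  have hRi : Integrable R ν := hI2.sub hI1
  have hR : ∫ q, R q ∂ν = h * E - ∫ q, kernelRatio σ J q.2 *
      gagliardoQuotient σ (fun x => φ (g q.1 x)) q.2 * gagliardoQuotient σ v q.2 ∂ν := by
    rw [← hI2', ← integral_sub hI2 hI1]
  have hreal : (∫ x, entropy θ (u t x)) + h / 2 * E ≤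
      (∫ x, entropy θ (u (t - h) x)) + 1 / 2 * ∫ q, R q ∂ν := by
    rw [hR]; linarith
  have hY0 : ∀ r, 0 ≤ r → 0 ≤ ∫ x, entropy θ (u r x) := fun r hr =>
    integral_nonneg_of_ae (by
      filter_upwards [hu_nonneg r hr] with x hx using hθ.entropy_nonneg hx)
  rw [hdis, ← ENNReal.ofReal_mul (by positivity), ← ENNReal.ofReal_add (hY0 t ht.le) (by positivity)]
  refine (ENNReal.ofReal_le_ofReal hreal).trans (ENNReal.ofReal_add_le.trans ?_)
  refine add_le_add le_rfl ?_
  rw [ENNReal.ofReal_mul (by norm_num), show Λ / 2 = 1 / 2 * Λ by ring,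
    ENNReal.ofReal_mul (by norm_num), mul_assoc]
  refine mul_le_mul_right ((ofReal_integral_le_lintegral hRi).trans ?_) _
  have hFm : Measurable fun q : ℝ × EuclideanSpace ℝ (Fin N) × EuclideanSpace ℝ (Fin N) =>
      ENNReal.ofReal |(gagliardoQuotient σ (fun x => φ (g q.1 x)) q.2 -
        gagliardoQuotient σ w q.2) * gagliardoQuotient σ v q.2| :=
    ((hg.measurable_quotient.sub ((measurable_gagliardoQuotient σ hwm).comp measurable_snd)).mul
      ((measurable_gagliardoQuotient σ hvm).comp measurable_snd)).norm.ennreal_ofReal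
  rw [← lintegral_prod _ hFm.aemeasurable, ← lintegral_const_mul _ hFm]
  refine lintegral_mono fun q => ?_
  rw [← ENNReal.ofReal_mul hΛ]
  refine ENNReal.ofReal_le_ofReal ?_
  have e : R q = -(kernelRatio σ J q.2 * ((gagliardoQuotient σ (fun x => φ (g q.1 x)) q.2 -
        gagliardoQuotient σ w q.2) * gagliardoQuotient σ v q.2)) := by
    simp only [R]; ring
  rw [e, abs_neg, abs_mul, abs_of_nonneg (hJb _).1]
  exact mul_le_mul_of_nonneg_right (hJb _).2 (abs_nonneg _)

end

/-! ### The entropy inequality -/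

section

variable {N : ℕ} {σ : ℝ} {φ θ : ℝ → ℝ} {B L ε : ℝ} {u g : ℝ → EuclideanSpace ℝ (Fin N) → ℝ}
  {u₀ : EuclideanSpace ℝ (Fin N) → ℝ}
  {J : EuclideanSpace ℝ (Fin N) → EuclideanSpace ℝ (Fin N) → ℝ}

theorem continuousOn_integral_entropy (hu : IsWeakSolution σ J φ u₀ u)
    (hθ : IsTruncation φ θ B L ε) :
    ContinuousOn (fun t => ∫ x, entropy θ (u t x)) (Ici 0) :=
  continuousOn_integral_of_lipschitz hu.continuous_L1 (F := fun _ a => entropy θ a)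
    (fun _ a b => hθ.abs_entropy_sub_le a b) fun t ht =>
      hθ.integrable_entropy (memLp_one_iff_integrable.1 (hu.memLp_one t ht))

theorem integral_entropy_nonneg
    (hu_nonneg : ∀ t : ℝ, 0 ≤ t → ∀ᵐ x ∂volume, 0 ≤ u t x) (hθ : IsTruncation φ θ B L ε)
    {t : ℝ} (ht : 0 ≤ t) : 0 ≤ ∫ x, entropy θ (u t x) :=
  integral_nonneg_of_ae (by
    filter_upwards [hu_nonneg t ht] with x hx using hθ.entropy_nonneg hx)

/-- The entropy inequality on `[a, b]`. -/
theorem entropy_add_dissipation_le (hN : N ≠ 0) (hσ : σ ∈ Ioo (0 : ℝ) 2)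
    (hg : IsRepresentative φ u g) (hu : IsWeakSolution σ J φ u₀ u)
    (hu_nonneg : ∀ t : ℝ, 0 ≤ t → ∀ᵐ x ∂volume, 0 ≤ u t x)
    (hJm : AEStronglyMeasurable (kernelRatio σ J) (volume.prod volume)) {Λ : ℝ}
    (hJb : ∀ p, 0 ≤ kernelRatio σ J p ∧ kernelRatio σ J p ≤ Λ) (hθ : IsTruncation φ θ B L ε)
    {a b : ℝ} (ha : 0 < a) (hab : a < b) :
    ENNReal.ofReal (∫ x, entropy θ (u b x)) +
        ENNReal.ofReal (1 / 2) * ∫⁻ t in Ioc a b, dissipation σ J φ θ (g t) ≤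
      ENNReal.ofReal (∫ x, entropy θ (u a x)) := by
  set Y : ℝ → ℝ := fun t => ∫ x, entropy θ (u t x) with hY
  have hYc : ContinuousOn Y (Ici 0) := continuousOn_integral_entropy hu hθ
  have hY0 : ∀ t, 0 ≤ t → 0 ≤ Y t := fun t ht => integral_entropy_nonneg hu_nonneg hθ ht
  have hΛ : 0 ≤ Λ := (hJb 0).1.trans (hJb 0).2
  set E := ∫⁻ t in Ioc a b, dissipation σ J φ θ (g t) with hE
  have hsub : Ioc a b ⊆ Ioi (0 : ℝ) := fun x hx => ha.trans hx.1
  have hYi : ∀ c d, 0 ≤ c → 0 ≤ d → IntervalIntegrable Y volume c d := fun c d hc hd =>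
    (hYc.mono fun x hx => (le_inf hc hd).trans hx.1).intervalIntegrable
  have hQm : Measurable fun q : ℝ × EuclideanSpace ℝ (Fin N) × EuclideanSpace ℝ (Fin N) =>
      gagliardoQuotient σ (fun x => θ (g q.1 x)) q.2 := by
    have h0 : Measurable fun q : ℝ × EuclideanSpace ℝ (Fin N) => θ (g q.1 q.2) :=
      hθ.continuous.measurable.comp hg.measurable
    have h1 : Measurable fun q : ℝ × EuclideanSpace ℝ (Fin N) × EuclideanSpace ℝ (Fin N) =>
        θ (g q.1 q.2.1) :=
      h0.comp (g := fun q : ℝ × EuclideanSpace ℝ (Fin N) => θ (g q.1 q.2))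
        (f := fun q : ℝ × EuclideanSpace ℝ (Fin N) × EuclideanSpace ℝ (Fin N) => (q.1, q.2.1))
        (by fun_prop)
    have h2 : Measurable fun q : ℝ × EuclideanSpace ℝ (Fin N) × EuclideanSpace ℝ (Fin N) =>
        θ (g q.1 q.2.2) :=
      h0.comp (g := fun q : ℝ × EuclideanSpace ℝ (Fin N) => θ (g q.1 q.2))
        (f := fun q : ℝ × EuclideanSpace ℝ (Fin N) × EuclideanSpace ℝ (Fin N) => (q.1, q.2.2))
        (by fun_prop)
    exact (h1.sub h2).mul (by fun_prop)
  have hQ2 : MemLp (fun q : ℝ × EuclideanSpace ℝ (Fin N) × EuclideanSpace ℝ (Fin N) =>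
      gagliardoQuotient σ (fun x => θ (g q.1 x)) q.2) 2
      ((volume.restrict (Ioc a b)).prod (volume.prod volume)) :=
    (hg.memLp_quotient hu ha hab).of_le_mul hQm.aestronglyMeasurable
      (Eventually.of_forall fun q => hθ.abs_gagliardoQuotient_le (hg.nonneg q.1) q.2)
  -- The one-step inequality integrated over `(a, b]`, with total error `Λ/2 · η h`. Finiteness of
  -- `E` comes out of it, since the right-hand side is finite.
  have key : ∀ η : ℝ, 0 < η → ∃ δ > 0, ∀ h, 0 < h → h < δ → h < a ∧ E < ⊤ ∧
      (∫ t in a..b, Y t) + h / 2 * E.toReal ≤ (∫ t in (a - h)..(b - h), Y t) + Λ / 2 * (η * h) := by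
    intro η hη
    obtain ⟨δ, hδ, hinc⟩ := exists_forall_lintegral_time_increment_le
      (hg.measurable_quotient (σ := σ)) hQm (half_lt_self ha)
      (hg.memLp_quotient hu (half_pos ha) ((half_lt_self ha).trans hab)) hQ2 hη
    refine ⟨min δ a, lt_min hδ ha, fun h h0 hh => ?_⟩
    have hhδ := hh.trans_le (min_le_left _ _)
    have hha := hh.trans_le (min_le_right _ _)
    refine ⟨hha, ?_⟩
    have hYh : ContinuousOn (fun t => Y (t - h)) (Ioc a b) :=
      hYc.comp (by fun_prop) fun t ht => by
        rw [mem_Ici]; linarith [ht.1]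
    have hptw : ∀ᵐ t ∂(volume.restrict (Ioc a b)),
        ENNReal.ofReal (Y t) + ENNReal.ofReal (h / 2) * dissipation σ J φ θ (g t) ≤
        ENNReal.ofReal (Y (t - h)) + ENNReal.ofReal (Λ / 2) *
          ∫⁻ r in Ioc (t - h) t, (∫⁻ p, ENNReal.ofReal
          |(gagliardoQuotient σ (fun x => φ (g r x)) p -
              gagliardoQuotient σ (fun x => φ (g t x)) p) *
            gagliardoQuotient σ (fun x => θ (g t x)) p| ∂(volume.prod volume)) := by
      filter_upwards [ae_restrict_of_ae_restrict_of_subset hsub hg.ae_eq,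
        ae_restrict_of_ae_restrict_of_subset hsub hu.memSobolev,
        ae_restrict_mem measurableSet_Ioc] with t h1 h2 h3
      exact entropy_increment_le hN hσ hg hu hu_nonneg hJm hJb hθ h0 (hha.trans h3.1) h1
        h2.gagliardoSq_lt_top
    have hint := lintegral_mono_ae hptw
    have hYm : AEMeasurable (fun t => ENNReal.ofReal (Y t)) (volume.restrict (Ioc a b)) :=
      ((hYc.mono fun x hx => mem_Ici.2 (hsub hx : (0 : ℝ) < x).le).aemeasurable measurableSet_Ioc).ennreal_ofReal
    have hYhm : AEMeasurable (fun t => ENNReal.ofReal (Y (t - h))) (volume.restrict (Ioc a b)) :=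
      (hYh.aemeasurable measurableSet_Ioc).ennreal_ofReal
    rw [lintegral_add_left' hYm, lintegral_add_left' hYhm, lintegral_const_mul' _ _ (by simp),
      lintegral_const_mul' _ _ (by simp), ← hE] at hint
    have i1 : Integrable Y (volume.restrict (Ioc a b)) :=
      (intervalIntegrable_iff_integrableOn_Ioc_of_le hab.le).1 (hYi a b ha.le (ha.trans hab).le)
    have i2' : IntervalIntegrable (fun t => Y (t - h)) volume a b := by
      have := (hYi (a - h) (b - h) (by linarith) (by linarith)).comp_sub_right h
      simpa using this
    have i2 : Integrable (fun t => Y (t - h)) (volume.restrict (Ioc a b)) :=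
      (intervalIntegrable_iff_integrableOn_Ioc_of_le hab.le).1 i2'
    have p1 : 0 ≤ᵐ[volume.restrict (Ioc a b)] Y := by
      filter_upwards [ae_restrict_mem measurableSet_Ioc] with t ht using hY0 t (hsub ht).le
    have p2 : 0 ≤ᵐ[volume.restrict (Ioc a b)] fun t => Y (t - h) := by
      filter_upwards [ae_restrict_mem measurableSet_Ioc] with t ht using
        hY0 _ (by linarith [ht.1])
    rw [← ofReal_integral_eq_lintegral_ofReal i1 p1, ← ofReal_integral_eq_lintegral_ofReal i2 p2,
      ← intervalIntegral.integral_of_le hab.le, ← intervalIntegral.integral_of_le hab.le,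
      intervalIntegral.integral_comp_sub_right] at hint
    have hint2 := hint.trans (add_le_add le_rfl (mul_le_mul_right (hinc h h0 hhδ) _))
    have hnn1 : 0 ≤ ∫ t in a..b, Y t :=
      intervalIntegral.integral_nonneg hab.le fun t ht => hY0 t (ha.le.trans ht.1)
    have hnn2 : 0 ≤ ∫ t in (a - h)..(b - h), Y t :=
      intervalIntegral.integral_nonneg (by linarith) fun t ht => hY0 t (by linarith [ht.1])
    rw [← ENNReal.ofReal_mul (by positivity), ← ENNReal.ofReal_add hnn2 (by positivity)] at hint2
    have hEt : E ≠ ⊤ := by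
      intro hE'
      rw [hE', ENNReal.mul_top (by simp [h0])] at hint2
      simp at hint2
    refine ⟨hEt.lt_top, ?_⟩
    rw [← ENNReal.ofReal_toReal hEt, ← ENNReal.ofReal_mul (by positivity),
      ← ENNReal.ofReal_add hnn1 (by positivity),
      ENNReal.ofReal_le_ofReal_iff (by positivity)] at hint2
    exact hint2
  have hEt : E < ⊤ := by
    obtain ⟨δ, hδ, h⟩ := key 1 one_pos
    exact (h (δ / 2) (half_pos hδ) (half_lt_self hδ)).2.1
  have hfin : Y b + 1 / 2 * E.toReal ≤ Y a := by
    have hη : ∀ η : ℝ, 0 < η → Y b + 1 / 2 * E.toReal ≤ Y a + (2 + Λ / 2) * η := by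
      intro η hη
      obtain ⟨δ, hδ, hk⟩ := key η hη
      have hca : ContinuousAt Y a := hYc.continuousAt (Ici_mem_nhds ha)
      have hcb : ContinuousAt Y b := hYc.continuousAt (Ici_mem_nhds (ha.trans hab))
      obtain ⟨δa, hδa, hka⟩ := Metric.continuousAt_iff.1 hca η hη
      obtain ⟨δb, hδb, hkb⟩ := Metric.continuousAt_iff.1 hcb η hη
      obtain ⟨h, h0, hh⟩ := exists_between (lt_min hδ (lt_min hδa hδb))
      obtain ⟨hha, -, hk⟩ := hk h h0 (hh.trans_le (min_le_left _ _))
      have hhδa := hh.trans_le ((min_le_right _ _).trans (min_le_left _ _))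
      have hhδb := hh.trans_le ((min_le_right _ _).trans (min_le_right _ _))
      -- The two integrals of `Y` differ by boundary layers of width `h` at `a` and at `b`.
      -- Continuity of `Y` costs `η h` at each end, whence the constant `2 + Λ/2` after division by
      -- `h`.
      have e := intervalIntegral.integral_interval_sub_interval_comm
        (hYi (a - h) (b - h) (by linarith) (by linarith)) (hYi a b (by linarith) (by linarith))
        (hYi (a - h) a (by linarith) (by linarith))
      have b1 : ∫ t in (a - h)..a, Y t ≤ h * (Y a + η) := by
        have := intervalIntegral.integral_mono_on (by linarith : a - h ≤ a)
          (hYi (a - h) a (by linarith) (by linarith))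
          (intervalIntegrable_const (c := Y a + η) (μ := volume)) fun t ht => by
            have := hka (x := t) (by rw [Real.dist_eq, abs_lt]; constructor <;> linarith [ht.1, ht.2])
            rw [Real.dist_eq, abs_lt] at this
            linarith [this.2]
        rw [intervalIntegral.integral_const, smul_eq_mul, sub_sub_cancel] at this
        exact this
      have b2 : h * (Y b - η) ≤ ∫ t in (b - h)..b, Y t := by
        have := intervalIntegral.integral_mono_on (by linarith : b - h ≤ b)
          (intervalIntegrable_const (c := Y b - η) (μ := volume))
          (hYi (b - h) b (by linarith) (by linarith)) fun t ht => by
            have := hkb (x := t) (by rw [Real.dist_eq, abs_lt]; constructor <;> linarith [ht.1, ht.2])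
            rw [Real.dist_eq, abs_lt] at this
            linarith [this.1]
        rw [intervalIntegral.integral_const, smul_eq_mul, sub_sub_cancel] at this
        exact this
      have : h * (Y b + 1 / 2 * E.toReal) ≤ h * (Y a + (2 + Λ / 2) * η) := by
        linarith
      exact le_of_mul_le_mul_left this h0
    refine le_of_forall_pos_le_add fun ζ hζ => ?_
    have h2 : 0 < 2 + Λ / 2 := by positivity
    have := hη (ζ / (2 + Λ / 2)) (by positivity)
    rwa [mul_div_cancel₀ _ h2.ne'] at this
  rw [← ENNReal.ofReal_toReal hEt.ne, ← ENNReal.ofReal_mul (by norm_num),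
    ← ENNReal.ofReal_add (hY0 b (ha.trans hab).le) (by positivity)]
  exact ENNReal.ofReal_le_ofReal hfin

/-- Entropies are nonincreasing in time. -/
theorem entropy_antitone (hN : N ≠ 0) (hσ : σ ∈ Ioo (0 : ℝ) 2)
    (hg : IsRepresentative φ u g) (hu : IsWeakSolution σ J φ u₀ u)
    (hu_nonneg : ∀ t : ℝ, 0 ≤ t → ∀ᵐ x ∂volume, 0 ≤ u t x)
    (hJm : AEStronglyMeasurable (kernelRatio σ J) (volume.prod volume)) {Λ : ℝ}
    (hJb : ∀ p, 0 ≤ kernelRatio σ J p ∧ kernelRatio σ J p ≤ Λ) (hθ : IsTruncation φ θ B L ε)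
    {a b : ℝ} (ha : 0 ≤ a) (hab : a < b) :
    ∫ x, entropy θ (u b x) ≤ ∫ x, entropy θ (u a x) := by
  have hpos : ∀ c, 0 < c → c < b → ∫ x, entropy θ (u b x) ≤ ∫ x, entropy θ (u c x) := by
    intro c hc hcb
    have := le_self_add.trans
      (entropy_add_dissipation_le hN hσ hg hu hu_nonneg hJm hJb hθ hc hcb)
    exact (ENNReal.ofReal_le_ofReal_iff (integral_entropy_nonneg hu_nonneg hθ hc.le)).1 this
  -- The equation gives the inequality only from positive times; continuity of the entropy at `a`
  -- covers `a = 0`.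
  have hc := (continuousOn_integral_entropy hu hθ a ha).mono
    (show Ioi a ⊆ Ici 0 from fun x hx => ha.trans (le_of_lt hx))
  refine ge_of_tendsto hc ?_
  filter_upwards [Ioo_mem_nhdsGT hab] with c hc using hpos c (ha.trans_lt hc.1) hc.2

end

/-! ### Truncated powers -/

section

/-- The projection of `ℝ` onto `[1/K, K]`. -/
noncomputable def clamp (K s : ℝ) : ℝ := min (max s (1 / K)) K

/-- The power `s ^ q` truncated at the levels `1/K` and `K`. -/
noncomputable def truncPow (q K s : ℝ) : ℝ := clamp K s ^ q - (1 / K) ^ q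

section

variable {q K : ℝ}

theorem inv_le_clamp (hK : 1 ≤ K) (s : ℝ) : 1 / K ≤ clamp K s :=
  le_min (le_max_right _ _) (((div_le_one (by linarith)).2 hK).trans hK)

theorem clamp_le (s : ℝ) : clamp K s ≤ K := min_le_right _ _

theorem clamp_mono : Monotone (clamp K) := fun _ _ h => min_le_min_right _ (max_le_max_right _ h)

theorem clamp_pos (hK : 1 ≤ K) (s : ℝ) : 0 < clamp K s :=
  (by positivity : 0 < 1 / K).trans_le (inv_le_clamp hK s)

theorem clamp_of_mem {s : ℝ} (h1 : 1 / K ≤ s) (h2 : s ≤ K) : clamp K s = s := by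
  rw [clamp, max_eq_left h1, min_eq_left h2]

theorem clamp_of_le (hK : 1 ≤ K) {s : ℝ} (h : s ≤ 1 / K) : clamp K s = 1 / K := by
  rw [clamp, max_eq_right h, min_eq_left (((div_le_one (by linarith)).2 hK).trans hK)]

theorem truncPow_monotone (hq : 0 < q) (hK : 1 ≤ K) : Monotone (truncPow q K) := fun _ _ h =>
  sub_le_sub_right (Real.rpow_le_rpow (clamp_pos hK _).le (clamp_mono h) hq.le) _

theorem truncPow_eq_zero (hK : 1 ≤ K) {s : ℝ} (h : s ≤ 1 / K) : truncPow q K s = 0 := by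
  rw [truncPow, clamp_of_le hK h, sub_self]

theorem truncPow_nonneg (hq : 0 < q) (hK : 1 ≤ K) (s : ℝ) : 0 ≤ truncPow q K s :=
  sub_nonneg.2 (Real.rpow_le_rpow (by positivity) (inv_le_clamp hK s) hq.le)

theorem continuous_truncPow (hq : 0 < q) : Continuous (truncPow q K) := by
  unfold truncPow clamp
  exact (Continuous.rpow_const (by fun_prop) fun _ => Or.inr hq.le).sub continuous_const

theorem truncPow_le_rpow (hq : 0 < q) (hK : 1 ≤ K) {s : ℝ} (hs : 0 ≤ s) :
    truncPow q K s ≤ s ^ q := by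
  rcases le_total s (1 / K) with h | h
  · rw [truncPow_eq_zero hK h]; positivity
  · refine (sub_le_self _ (by positivity)).trans
      (Real.rpow_le_rpow (clamp_pos hK s).le ?_ hq.le)
    rw [clamp, max_eq_left h]
    exact min_le_left _ _

/-- By monotonicity `b` may be replaced by `a / 2`. The lower level is `2 / K` so that `a / 2` also
lies in the range where the power is not truncated. -/
theorem truncPow_sub_ge (hq : 0 < q) (hK : 1 ≤ K) {a b : ℝ} (h1 : 2 / K ≤ a) (h2 : a ≤ K)
    (hb : b ≤ a / 2) : (1 - (1 / 2 : ℝ) ^ q) * a ^ q ≤ truncPow q K a - truncPow q K b := by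
  have hK0 : 0 < K := by linarith
  have h3 : 1 / K ≤ a / 2 := by
    have : 2 / K = 2 * (1 / K) := by ring
    linarith
  have ha : 0 < a := lt_of_lt_of_le (by positivity) h1
  have h4 : truncPow q K b ≤ truncPow q K (a / 2) := truncPow_monotone hq hK hb
  have e : (a / 2) ^ q = (1 / 2 : ℝ) ^ q * a ^ q := by
    rw [← Real.mul_rpow (by norm_num) ha.le]; congr 1; ring
  have h5 : truncPow q K a - truncPow q K (a / 2) = a ^ q - (a / 2) ^ q := by
    rw [truncPow, truncPow, clamp_of_mem (by linarith) h2, clamp_of_mem h3 (by linarith)]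
    ring
  rw [e] at h5
  linarith

end

variable {φ : ℝ → ℝ} {m c q K : ℝ}

/-- Mean value inequality: as `m < 1`, the lower bound `c s^(m-1)` for the derivative is smallest at
the right end `a`. Continuity of `φ` at `0` allows `b = 0`. -/
theorem mul_sub_le_of_deriv_ge (hφ : IsFastDiffusionNonlinearity φ) (hm : m < 1) (hc : 0 < c)
    (hφ' : ∀ s : ℝ, 0 < s → c * s ^ (m - 1) ≤ deriv φ s) {a b : ℝ} (hb : 0 ≤ b) (hba : b ≤ a) :
    c * a ^ (m - 1) * (a - b) ≤ φ a - φ b := by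
  refine (convex_Icc b a).mul_sub_le_image_sub_of_le_deriv
    (hφ.continuousOn.mono fun x hx => hb.trans hx.1) ?_ ?_ b (left_mem_Icc.2 hba) a
    (right_mem_Icc.2 hba) hba
  · rw [interior_Icc]
    exact (hφ.contDiffOn.differentiableOn (by simp)).mono fun x hx => hb.trans_lt hx.1
  · rw [interior_Icc]
    intro x hx
    have hx0 : 0 < x := hb.trans_lt hx.1
    refine le_trans (mul_le_mul_of_nonneg_left ?_ hc.le) (hφ' x hx0)
    exact Real.rpow_le_rpow_of_nonpos hx0 hx.2.le (by linarith)

theorem exists_rpow_sub_le (q : ℝ) (hK : 1 ≤ K) :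
    ∃ C : ℝ, 0 ≤ C ∧ ∀ x y, 1 / K ≤ y → y ≤ x → x ≤ K → x ^ q - y ^ q ≤ C * (x - y) := by
  have hK0 : 0 < 1 / K := by positivity
  have hc : ContinuousOn (fun s : ℝ => q * s ^ (q - 1)) (Icc (1 / K) K) :=
    continuousOn_const.mul (continuousOn_id.rpow_const fun x hx =>
      Or.inl (hK0.trans_le hx.1).ne')
  obtain ⟨C, hC⟩ := isCompact_Icc.exists_bound_of_continuousOn hc
  have hC0 : 0 ≤ C := (norm_nonneg _).trans
    (hC K (right_mem_Icc.2 (((div_le_one (by linarith)).2 hK).trans hK)))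
  refine ⟨C, hC0, fun x y h1 h2 h3 => ?_⟩
  have hd : ∀ s ∈ Icc (1 / K) K, HasDerivAt (fun s : ℝ => s ^ q) (q * s ^ (q - 1)) s :=
    fun s hs => Real.hasDerivAt_rpow_const (Or.inl (hK0.trans_le hs.1).ne')
  refine (convex_Icc (1 / K) K).image_sub_le_mul_sub_of_deriv_le
    (fun s hs => (hd s hs).continuousAt.continuousWithinAt)
    (fun s hs => (hd s (interior_subset hs)).differentiableAt.differentiableWithinAt)
    (fun s hs => ?_) y ⟨h1, h2.trans h3⟩ x ⟨h1.trans h2, h3⟩ h2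
  rw [(hd s (interior_subset hs)).deriv]
  exact (le_abs_self _).trans (hC s (interior_subset hs))

/-- On `[1/K, K]` the power is Lipschitz and `φ'` is at least `c K^(m-1)`; outside, the truncation
is constant. The quotient of the two constants is the Lipschitz constant with respect to `φ`. -/
theorem exists_isTruncation_truncPow (hφ : IsFastDiffusionNonlinearity φ) (hm : m < 1) (hc : 0 < c)
    (hφ' : ∀ s : ℝ, 0 < s → c * s ^ (m - 1) ≤ deriv φ s) (hq : 0 < q) (hK : 1 ≤ K) :
    ∃ B L ε, IsTruncation φ (truncPow q K) B L ε := by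
  obtain ⟨C, hC0, hC⟩ := exists_rpow_sub_le q hK
  have hK0 : 0 < K := by linarith
  have hmono : ∀ a b, 0 ≤ b → b ≤ a → φ b ≤ φ a := fun a b hb hba =>
    hφ.strictMonoOn.monotoneOn hb (hb.trans hba) hba
  have hD : 0 < c * K ^ (m - 1) := mul_pos hc (Real.rpow_pos_of_pos hK0 _)
  have key : ∀ a b, 0 ≤ b → b ≤ a →
      truncPow q K a - truncPow q K b ≤ C / (c * K ^ (m - 1)) * (φ a - φ b) := by
    intro a b hb hba
    have hL : 0 ≤ C / (c * K ^ (m - 1)) := by positivity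
    have hφab := hmono a b hb hba
    by_cases h1 : a ≤ 1 / K
    · rw [truncPow_eq_zero hK h1, truncPow_eq_zero hK (hba.trans h1), sub_zero]
      exact mul_nonneg hL (sub_nonneg.2 hφab)
    by_cases h2 : K ≤ b
    · have e : ∀ s, K ≤ s → clamp K s = K := fun s hs => by
        rw [clamp]; exact min_eq_right (hs.trans (le_max_left _ _))
      rw [truncPow, truncPow, e a (h2.trans hba), e b h2, sub_self]
      exact mul_nonneg hL (sub_nonneg.2 hφab)
    -- Now `b ≤ clamp K b ≤ clamp K a ≤ a`, so the increment of `φ` over `[b, a]` dominates the one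
    -- between the clamped points.
    push Not at h1 h2
    have ha' : clamp K a ≤ a := by rw [clamp, max_eq_left h1.le]; exact min_le_left _ _
    have hb' : b ≤ clamp K b := le_min (le_max_left _ _) h2.le
    have hab' : clamp K b ≤ clamp K a := clamp_mono hba
    have e1 : truncPow q K a - truncPow q K b = clamp K a ^ q - clamp K b ^ q := by
      simp only [truncPow]; ring
    have e2 := hC _ _ (inv_le_clamp hK b) hab' (clamp_le a)
    have e3 := mul_sub_le_of_deriv_ge hφ hm hc hφ' (clamp_pos hK b).le hab'
    have e4 : K ^ (m - 1) ≤ clamp K a ^ (m - 1) :=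
      Real.rpow_le_rpow_of_nonpos (clamp_pos hK a) (clamp_le a) (by linarith)
    have e5 : c * K ^ (m - 1) * (clamp K a - clamp K b) ≤ φ a - φ b := by
      have i1 := hmono a _ (clamp_pos hK a).le ha'
      have i2 := hmono _ b hb hb'
      have i3 : c * K ^ (m - 1) * (clamp K a - clamp K b) ≤
          c * clamp K a ^ (m - 1) * (clamp K a - clamp K b) :=
        mul_le_mul_of_nonneg_right (mul_le_mul_of_nonneg_left e4 hc.le) (sub_nonneg.2 hab')
      linarith
    rw [e1, div_mul_eq_mul_div, le_div_iff₀ hD]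
    calc (clamp K a ^ q - clamp K b ^ q) * (c * K ^ (m - 1))
        ≤ C * (clamp K a - clamp K b) * (c * K ^ (m - 1)) := mul_le_mul_of_nonneg_right e2 hD.le
      _ = C * (c * K ^ (m - 1) * (clamp K a - clamp K b)) := by ring
      _ ≤ C * (φ a - φ b) := mul_le_mul_of_nonneg_left e5 hC0
  refine ⟨K ^ q, C / (c * K ^ (m - 1)), 1 / K, continuous_truncPow hq, truncPow_monotone hq hK,
    truncPow_nonneg hq hK, fun s => ?_, by positivity, fun s hs => truncPow_eq_zero hK hs, ?_, ?_⟩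
  · exact (sub_le_self _ (by positivity)).trans
      (Real.rpow_le_rpow (clamp_pos hK s).le (clamp_le s) hq.le)
  · intro a b ha hb
    rcases le_total b a with h | h
    · rw [abs_of_nonneg (sub_nonneg.2 (truncPow_monotone hq hK h)),
        abs_of_nonneg (sub_nonneg.2 (hmono a b hb h))]
      exact key a b hb h
    · rw [abs_sub_comm, abs_sub_comm (φ a), abs_of_nonneg (sub_nonneg.2 (truncPow_monotone hq hK h)),
        abs_of_nonneg (sub_nonneg.2 (hmono b a ha h))]
      exact key b a ha h
  · intro a b ha hb
    rcases le_total b a with h | h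
    · exact mul_nonneg (sub_nonneg.2 (hmono a b hb h))
        (sub_nonneg.2 (truncPow_monotone hq hK h))
    · exact mul_nonneg_of_nonpos_of_nonpos (sub_nonpos.2 (hmono b a ha h))
        (sub_nonpos.2 (truncPow_monotone hq hK h))

theorem tendsto_truncPow (hq : 0 < q) {s : ℝ} (hs : 0 ≤ s) :
    Tendsto (fun n : ℕ => truncPow q (n + 1 : ℝ) s) atTop (𝓝 (s ^ q)) := by
  have hK : ∀ n : ℕ, (1 : ℝ) ≤ n + 1 := fun n => by simp
  have h0 := tendsto_one_div_add_atTop_nhds_zero_nat (𝕜 := ℝ)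
  rcases hs.eq_or_lt with rfl | hs
  · rw [Real.zero_rpow hq.ne']
    refine tendsto_const_nhds.congr fun n => ?_
    rw [truncPow_eq_zero (hK n) (by positivity)]
  · have h1 : Tendsto (fun n : ℕ => s ^ q - (1 / (n + 1 : ℝ)) ^ q) atTop (𝓝 (s ^ q - 0 ^ q)) :=
      tendsto_const_nhds.sub (h0.rpow_const (Or.inr hq.le))
    rw [Real.zero_rpow hq.ne', sub_zero] at h1
    refine h1.congr' ?_
    filter_upwards [h0.eventually (gt_mem_nhds hs), eventually_ge_atTop ⌈s⌉₊] with n hn hn'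
    have : s ≤ n := (Nat.le_ceil s).trans (by exact_mod_cast hn')
    rw [truncPow, clamp_of_mem hn.le (by linarith)]

theorem entropy_truncPow_le (hq : 0 < q) (hK : 1 ≤ K) {s : ℝ} (hs : 0 ≤ s) :
    entropy (truncPow q K) s ≤ s ^ (q + 1) / (q + 1) := by
  have h := intervalIntegral.integral_mono_on hs
    ((continuous_truncPow (K := K) hq).intervalIntegrable (μ := volume) _ _)
    (intervalIntegral.intervalIntegrable_rpow' (by linarith : -1 < q))
    fun x hx => truncPow_le_rpow hq hK hx.1
  rwa [integral_rpow (Or.inl (by linarith)), Real.zero_rpow (by linarith), sub_zero] at h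

theorem tendsto_entropy_truncPow (hq : 0 < q) {s : ℝ} (hs : 0 ≤ s) :
    Tendsto (fun n : ℕ => entropy (truncPow q (n + 1 : ℝ)) s) atTop
      (𝓝 (s ^ (q + 1) / (q + 1))) := by
  have hK : ∀ n : ℕ, (1 : ℝ) ≤ n + 1 := fun n => by simp
  have e : s ^ (q + 1) / (q + 1) = ∫ x in (0 : ℝ)..s, x ^ q := by
    rw [integral_rpow (Or.inl (by linarith)), Real.zero_rpow (by linarith), sub_zero]
  rw [e]
  refine intervalIntegral.tendsto_integral_filter_of_dominated_convergence (fun x => x ^ q)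
    (Eventually.of_forall fun n => (continuous_truncPow hq).aestronglyMeasurable)
    (Eventually.of_forall fun n => Eventually.of_forall fun x hx => ?_)
    (intervalIntegral.intervalIntegrable_rpow' (by linarith))
    (Eventually.of_forall fun x hx => ?_)
  · rw [uIoc_of_le hs] at hx
    rw [Real.norm_of_nonneg (truncPow_nonneg hq (hK n) x)]
    exact truncPow_le_rpow hq (hK n) hx.1.le
  · rw [uIoc_of_le hs] at hx
    exact tendsto_truncPow hq hx.1.le

end

/-! ### The nonlinear Sobolev inequality -/

section

variable {N : ℕ} {σ : ℝ} {p : ℝ}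

/-- The kernel mass seen from `x` on the set where `f` is at most half of `f x`. -/
theorem exists_mul_rpow_le_lintegral_kernel (hN : N ≠ 0) (hσ : 0 < σ) (hp : 0 < p) :
    ∃ C : ℝ, 0 < C ∧ ∀ (f : EuclideanSpace ℝ (Fin N) → ℝ), Measurable f → (∀ x, 0 ≤ f x) →
      ∀ lam : ℝ, 0 < lam → ∫⁻ x, ENNReal.ofReal (f x ^ p) ≤ ENNReal.ofReal lam →
      ∀ x, 0 < f x → ENNReal.ofReal (C * lam ^ (-(σ / N)) * f x ^ (p * (σ / N))) ≤
        ∫⁻ y in {y | f y ≤ f x / 2}, ENNReal.ofReal (‖x - y‖ ^ (-((N : ℝ) + σ))) := by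
  have hN0 : (0 : ℝ) < N := by exact_mod_cast Nat.pos_of_ne_zero hN
  have hne : Nontrivial (EuclideanSpace ℝ (Fin N)) := by
    have : Nonempty (Fin N) := Fin.pos_iff_nonempty.1 (Nat.pos_of_ne_zero hN)
    infer_instance
  set β : ℝ := (volume (Metric.ball (0 : EuclideanSpace ℝ (Fin N)) 1)).toReal with hβ
  have hβ0 : 0 < β := ENNReal.toReal_pos (Metric.measure_ball_pos volume _ one_pos).ne'
    measure_ball_lt_top.ne
  refine ⟨β / 2 * (2 * 2 ^ p / β) ^ (-(σ / N)), by positivity, ?_⟩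
  intro f hf hf0 lam hlam hint x hx
  set a := f x with ha
  -- Chebyshev's bound for the measure of `{f > a/2}`. The radius `r` is chosen so that the ball of
  -- radius `r` has measure `2 μ₀`, which leaves measure at least `μ₀` for `{f ≤ a/2}`.
  set μ₀ : ℝ := (2 / a) ^ p * lam with hμ₀
  have hμ₀pos : 0 < μ₀ := by positivity
  set r : ℝ := (2 * μ₀ / β) ^ (1 / (N : ℝ)) with hr
  have hr0 : 0 < r := by positivity
  have hrN : β * r ^ N = 2 * μ₀ := by
    rw [hr, ← Real.rpow_natCast, ← Real.rpow_mul (by positivity), one_div_mul_cancel hN0.ne',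
      Real.rpow_one]
    field_simp
  have hA : volume {y | a / 2 < f y} ≤ ENNReal.ofReal μ₀ := by
    have h1 := mul_meas_ge_le_lintegral (μ := volume) ((hf.pow_const p).ennreal_ofReal)
      (ENNReal.ofReal ((a / 2) ^ p))
    have h2 : {y | a / 2 < f y} ⊆
        {y | ENNReal.ofReal ((a / 2) ^ p) ≤ ENNReal.ofReal (f y ^ p)} := fun y hy =>
      ENNReal.ofReal_le_ofReal (Real.rpow_le_rpow (by positivity) (le_of_lt hy) hp.le)
    have h3 : ENNReal.ofReal ((a / 2) ^ p) * volume {y | a / 2 < f y} ≤ ENNReal.ofReal lam :=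
      (mul_le_mul_right (measure_mono h2) _).trans (h1.trans hint)
    have h4 : ENNReal.ofReal ((2 / a) ^ p) * ENNReal.ofReal ((a / 2) ^ p) = 1 := by
      rw [← ENNReal.ofReal_mul (by positivity), ← Real.mul_rpow (by positivity) (by positivity),
        div_mul_div_cancel₀ hx.ne', div_self two_ne_zero, Real.one_rpow, ENNReal.ofReal_one]
    calc volume {y | a / 2 < f y}
        = ENNReal.ofReal ((2 / a) ^ p) *
            (ENNReal.ofReal ((a / 2) ^ p) * volume {y | a / 2 < f y}) := by
          rw [← mul_assoc, h4, one_mul]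
      _ ≤ ENNReal.ofReal ((2 / a) ^ p) * ENNReal.ofReal lam := mul_le_mul_right h3 _
      _ = ENNReal.ofReal μ₀ := by rw [← ENNReal.ofReal_mul (by positivity)]
  have hball : volume (Metric.ball x r) = ENNReal.ofReal (2 * μ₀) := by
    rw [Measure.addHaar_ball volume x hr0.le, finrank_euclideanSpace_fin, ← hrN, mul_comm β,
      ENNReal.ofReal_mul (by positivity), hβ, ENNReal.ofReal_toReal measure_ball_lt_top.ne]
  have hS : ENNReal.ofReal μ₀ ≤ volume (Metric.ball x r ∩ {y | f y ≤ a / 2}) := by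
    have h1 : volume (Metric.ball x r) ≤
        volume (Metric.ball x r ∩ {y | f y ≤ a / 2}) + volume {y | a / 2 < f y} := by
      refine (measure_mono fun y hy => ?_).trans (measure_union_le _ _)
      rcases le_or_gt (f y) (a / 2) with h | h
      · exact Or.inl ⟨hy, h⟩
      · exact Or.inr h
    rw [hball, two_mul, ENNReal.ofReal_add hμ₀pos.le hμ₀pos.le] at h1
    exact (ENNReal.add_le_add_iff_right ENNReal.ofReal_ne_top).1
      (h1.trans (add_le_add le_rfl hA))
  have hval : β / 2 * (2 * 2 ^ p / β) ^ (-(σ / N)) * lam ^ (-(σ / N)) * a ^ (p * (σ / N)) =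
      r ^ (-((N : ℝ) + σ)) * μ₀ := by
    have e1 : r ^ (-((N : ℝ) + σ)) = (2 * μ₀ / β) ^ (-(σ / N)) * (2 * μ₀ / β)⁻¹ := by
      rw [hr, ← Real.rpow_mul (by positivity), ← Real.rpow_neg_one (2 * μ₀ / β),
        ← Real.rpow_add (by positivity)]
      congr 1
      field_simp
      ring
    have e2 : 2 * μ₀ / β = 2 * 2 ^ p / β * lam * (a ^ p)⁻¹ := by
      rw [hμ₀, Real.div_rpow (by norm_num) hx.le]
      ring
    have e3 : (2 * μ₀ / β) ^ (-(σ / N)) =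
        (2 * 2 ^ p / β) ^ (-(σ / N)) * lam ^ (-(σ / N)) * a ^ (p * (σ / N)) := by
      rw [e2, Real.mul_rpow (by positivity) (by positivity),
        Real.mul_rpow (by positivity) (by positivity), ← Real.rpow_neg hx.le,
        ← Real.rpow_mul hx.le]
      congr 2
      ring
    rw [e1, e3]
    field_simp
  rw [hval, ENNReal.ofReal_mul (by positivity)]
  calc ENNReal.ofReal (r ^ (-((N : ℝ) + σ))) * ENNReal.ofReal μ₀
      ≤ ENNReal.ofReal (r ^ (-((N : ℝ) + σ))) *
          volume (Metric.ball x r ∩ {y | f y ≤ a / 2}) := mul_le_mul_right hS _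
    _ = ∫⁻ y in Metric.ball x r ∩ {y | f y ≤ a / 2}, ENNReal.ofReal (r ^ (-((N : ℝ) + σ))) := by
        rw [setLIntegral_const]
    _ ≤ ∫⁻ y in Metric.ball x r ∩ {y | f y ≤ a / 2},
          ENNReal.ofReal (‖x - y‖ ^ (-((N : ℝ) + σ))) := by
        refine setLIntegral_mono' (measurableSet_ball.inter
          (measurableSet_le hf measurable_const)) fun y hy => ENNReal.ofReal_le_ofReal ?_
        have hxy : x ≠ y := by
          rintro rfl
          have : a ≤ a / 2 := hy.2
          linarith
        refine Real.rpow_le_rpow_of_nonpos (norm_pos_iff.2 (sub_ne_zero.2 hxy)) ?_ (by linarith)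
        rw [← dist_eq_norm, dist_comm]
        exact (Metric.mem_ball.1 hy.1).le
    _ ≤ _ := lintegral_mono_set inter_subset_right

/-- A nonlinear Sobolev inequality: lower bound for the dissipation of truncated powers. -/
theorem exists_mul_lintegral_le_dissipation (hN : N ≠ 0) (hσ : 0 < σ)
    {J : EuclideanSpace ℝ (Fin N) → EuclideanSpace ℝ (Fin N) → ℝ} {Λ : ℝ} (hΛ : 0 < Λ)
    (hJ0 : ∀ p, 0 ≤ kernelRatio σ J p) (hJ : ∀ p, p.1 ≠ p.2 → 1 / Λ ≤ kernelRatio σ J p)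
    {φ : ℝ → ℝ} (hφ : IsFastDiffusionNonlinearity φ) {m c q : ℝ} (hm : m < 1) (hc : 0 < c)
    (hφ' : ∀ s : ℝ, 0 < s → c * s ^ (m - 1) ≤ deriv φ s) (hq : 0 < q)
    (hqm : (q + 1) * (σ / N) = 1 - m) :
    ∃ C : ℝ, 0 < C ∧ ∀ (f : EuclideanSpace ℝ (Fin N) → ℝ), Measurable f → (∀ x, 0 ≤ f x) →
      ∀ lam : ℝ, 0 < lam → ∫⁻ x, ENNReal.ofReal (f x ^ (q + 1)) ≤ ENNReal.ofReal lam →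
      ∀ K : ℝ, 1 ≤ K → ENNReal.ofReal (C * lam ^ (-(σ / N))) *
        ∫⁻ x in {x | 2 / K ≤ f x ∧ f x ≤ K}, ENNReal.ofReal (f x ^ (q + 1)) ≤
          dissipation σ J φ (truncPow q K) f := by
  obtain ⟨C, hC, hker⟩ := exists_mul_rpow_le_lintegral_kernel hN hσ (by linarith : 0 < q + 1)
  have hq1 : 0 < 1 - (1 / 2 : ℝ) ^ q := sub_pos.2 (Real.rpow_lt_one (by norm_num) (by norm_num) hq)
  set c1 : ℝ := c / 2 * (1 - (1 / 2 : ℝ) ^ q) / Λ with hc1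
  have hc1pos : 0 < c1 := by positivity
  refine ⟨c1 * C, by positivity, ?_⟩
  intro f hf hf0 lam hlam hint K hK
  have hK0 : 0 < K := by linarith
  obtain ⟨B, L, ε, hθ⟩ := exists_isTruncation_truncPow hφ hm hc hφ' hq hK
  set S : Set (EuclideanSpace ℝ (Fin N)) := {x | 2 / K ≤ f x ∧ f x ≤ K} with hS
  have hSm : MeasurableSet S :=
    (measurableSet_le measurable_const hf).inter (measurableSet_le hf measurable_const)
  -- Only pairs with a drop by a factor of two are kept. There the increments of `φ` and of the
  -- truncated power are at least multiples of `f(x)^m` and `f(x)^q`.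
  let A : Set (EuclideanSpace ℝ (Fin N) × EuclideanSpace ℝ (Fin N)) :=
    {p | p.1 ∈ S ∧ f p.2 ≤ f p.1 / 2}
  have hAm : MeasurableSet A :=
    (measurable_fst hSm).inter (measurableSet_le (hf.comp measurable_snd)
      ((hf.comp measurable_fst).div_const 2))
  let H : EuclideanSpace ℝ (Fin N) × EuclideanSpace ℝ (Fin N) → ℝ≥0∞ := A.indicator fun p =>
    ENNReal.ofReal (c1 * f p.1 ^ (m + q)) * ENNReal.ofReal (‖p.1 - p.2‖ ^ (-((N : ℝ) + σ)))
  have hHm : Measurable H := by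
    refine Measurable.indicator ?_ hAm
    have h1 : Measurable fun p : EuclideanSpace ℝ (Fin N) × EuclideanSpace ℝ (Fin N) =>
      f p.1 ^ (m + q) := (hf.comp measurable_fst).pow_const _
    fun_prop
  have hle : ∀ p, H p ≤ ENNReal.ofReal (kernelRatio σ J p *
      gagliardoQuotient σ (fun x => φ (f x)) p *
        gagliardoQuotient σ (fun x => truncPow q K (f x)) p) := by
    intro p
    by_cases hpA : p ∈ A
    · simp only [H, indicator_of_mem hpA]
      obtain ⟨⟨h1, h2⟩, h3⟩ := hpA
      have ha : 0 < f p.1 := lt_of_lt_of_le (by positivity) h1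
      rw [← ENNReal.ofReal_mul (by positivity), mul_assoc (kernelRatio σ J p),
        gagliardoQuotient_mul, ← mul_assoc]
      refine ENNReal.ofReal_le_ofReal (mul_le_mul_of_nonneg_right ?_
        (Real.rpow_nonneg (norm_nonneg _) _))
      have hne : p.1 ≠ p.2 := by
        intro h
        rw [← h] at h3
        linarith
      have e1 : c / 2 * f p.1 ^ m ≤ φ (f p.1) - φ (f p.2) := by
        refine le_trans ?_ (mul_sub_le_of_deriv_ge hφ hm hc hφ' (hf0 p.2) (by linarith))
        have : f p.1 ^ m = f p.1 ^ (m - 1) * f p.1 := by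
          rw [← Real.rpow_add_one ha.ne']; congr 1; ring
        rw [this]
        have h4 : 0 ≤ c * f p.1 ^ (m - 1) := by positivity
        have := mul_le_mul_of_nonneg_left (show f p.1 / 2 ≤ f p.1 - f p.2 by linarith) h4
        linarith
      have e2 := truncPow_sub_ge hq hK h1 h2 h3
      calc c1 * f p.1 ^ (m + q)
          = 1 / Λ * ((c / 2 * f p.1 ^ m) * ((1 - (1 / 2 : ℝ) ^ q) * f p.1 ^ q)) := by
            rw [Real.rpow_add ha, hc1]; ring
        _ ≤ kernelRatio σ J p * ((φ (f p.1) - φ (f p.2)) *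
              (truncPow q K (f p.1) - truncPow q K (f p.2))) := by
            refine mul_le_mul (hJ p hne) (mul_le_mul e1 e2 (by positivity) ?_)
              (by positivity) (hJ0 p)
            exact le_trans (by positivity) e1
    · simp [H, indicator_of_notMem hpA]
  calc ENNReal.ofReal (c1 * C * lam ^ (-(σ / N))) * ∫⁻ x in S, ENNReal.ofReal (f x ^ (q + 1))
      = ∫⁻ x in S, ENNReal.ofReal (c1 * C * lam ^ (-(σ / N))) *
          ENNReal.ofReal (f x ^ (q + 1)) := by
        rw [lintegral_const_mul' _ _ ENNReal.ofReal_ne_top]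
    _ ≤ ∫⁻ x in S, ∫⁻ y, H (x, y) := by
        refine setLIntegral_mono' hSm fun x hx => ?_
        have ha : 0 < f x := lt_of_lt_of_le (by positivity) hx.1
        have hk := hker f hf hf0 lam hlam hint x ha
        have e : ∫⁻ y, H (x, y) = ENNReal.ofReal (c1 * f x ^ (m + q)) *
            ∫⁻ y in {y | f y ≤ f x / 2}, ENNReal.ofReal (‖x - y‖ ^ (-((N : ℝ) + σ))) := by
          rw [← lintegral_const_mul' _ _ ENNReal.ofReal_ne_top,
            ← lintegral_indicator (measurableSet_le hf measurable_const)]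
          refine lintegral_congr fun y => ?_
          by_cases hy : f y ≤ f x / 2
          · rw [indicator_of_mem (show y ∈ {y | f y ≤ f x / 2} from hy)]
            exact indicator_of_mem (show (x, y) ∈ A from ⟨hx, hy⟩) _
          · rw [indicator_of_notMem (show y ∉ {y | f y ≤ f x / 2} from hy)]
            exact indicator_of_notMem (show (x, y) ∉ A from fun h => hy h.2) _
        rw [e]
        refine le_trans (le_of_eq ?_) (mul_le_mul_right hk _)
        rw [← ENNReal.ofReal_mul (by positivity), ← ENNReal.ofReal_mul (by positivity)]
        congr 1
        -- The choice of `q` enters here: the kernel mass supplies the missing power `1 - m`.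
        have e2 : f x ^ (q + 1) = f x ^ (m + q) * f x ^ ((q + 1) * (σ / N)) := by
          rw [hqm, ← Real.rpow_add ha]; congr 1; ring
        rw [e2]; ring
    _ ≤ ∫⁻ x, ∫⁻ y, H (x, y) := setLIntegral_le_lintegral _ _
    _ = ∫⁻ p, H p ∂(volume.prod volume) := (lintegral_prod _ hHm.aemeasurable).symm
    _ ≤ dissipation σ J φ (truncPow q K) f := lintegral_mono hle

end

/-! ### Decay of the power mass and finite extinction time -/

section

theorem lintegral_le_of_tendsto_of_forall_le {α : Type*} [MeasurableSpace α] {μ : Measure α}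
    {f : ℕ → α → ℝ≥0∞} {F : α → ℝ≥0∞} (hf : ∀ n, AEMeasurable (f n) μ)
    (hlim : ∀ᵐ x ∂μ, Tendsto (fun n => f n x) atTop (𝓝 (F x))) {C : ℝ≥0∞}
    (hC : ∀ n, ∫⁻ x, f n x ∂μ ≤ C) : ∫⁻ x, F x ∂μ ≤ C :=
  calc ∫⁻ x, F x ∂μ = ∫⁻ x, liminf (fun n => f n x) atTop ∂μ :=
        lintegral_congr_ae (by filter_upwards [hlim] with x hx using hx.liminf_eq.symm)
    _ ≤ liminf (fun n => ∫⁻ x, f n x ∂μ) atTop := lintegral_liminf_le' hf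
    _ ≤ C := liminf_le_of_frequently_le' (Frequently.of_forall hC)

/-- Halving in time `D λ^κ` from every level `λ` forces extinction in finite time. -/
theorem exists_forall_eq_zero_of_halving {V : ℝ → ℝ≥0∞} (hV : ∀ s t, 0 ≤ s → s < t → V t ≤ V s)
    (h0 : V 0 < ⊤) {D κ : ℝ} (hD : 0 < D) (hκ : 0 < κ)
    (hhalf : ∀ s lam : ℝ, 0 < s → 0 < lam → V s ≤ ENNReal.ofReal lam →
      V (s + D * lam ^ κ) ≤ ENNReal.ofReal (lam / 2)) :
    ∃ T : ℝ, 0 < T ∧ ∀ t, T ≤ t → V t = 0 := by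
  -- The added `1` makes the first level positive even when `V 0 = 0`.
  set l : ℝ := (V 0).toReal + 1 with hl
  have hl0 : 0 < l := by positivity
  set ρ : ℝ := (1 / 2 : ℝ) ^ κ with hρ
  have hρ0 : 0 < ρ := by positivity
  have hρ1 : ρ < 1 := Real.rpow_lt_one (by norm_num) (by norm_num) hκ
  -- Times at which `V` has dropped to `l / 2^n`. They start at `1` because halving is assumed only
  -- from positive times.
  let τ : ℕ → ℝ := fun n => 1 + D * l ^ κ * ∑ i ∈ Finset.range n, ρ ^ i
  have hτ1 : ∀ n, 1 ≤ τ n := fun n => by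
    have : 0 ≤ D * l ^ κ * ∑ i ∈ Finset.range n, ρ ^ i := by positivity
    simp only [τ]; linarith
  have hτ : ∀ n, V (τ n) ≤ ENNReal.ofReal (l * (1 / 2) ^ n) := by
    intro n
    induction n with
    | zero =>
      refine (hV 0 (τ 0) le_rfl (by linarith [hτ1 0])).trans ?_
      rw [pow_zero, mul_one, ← ENNReal.ofReal_toReal h0.ne]
      exact ENNReal.ofReal_le_ofReal (by linarith)
    | succ n ih =>
      have h1 := hhalf (τ n) (l * (1 / 2) ^ n) (by linarith [hτ1 n]) (by positivity) ih
      have e1 : τ n + D * (l * (1 / 2) ^ n) ^ κ = τ (n + 1) := by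
        have : ((1 / 2 : ℝ) ^ n) ^ κ = ρ ^ n := by
          rw [hρ, ← Real.rpow_natCast, ← Real.rpow_natCast, ← Real.rpow_mul (by norm_num),
            ← Real.rpow_mul (by norm_num), mul_comm]
        simp only [τ]
        rw [Finset.sum_range_succ, Real.mul_rpow hl0.le (by positivity), this]
        ring
      have e2 : l * (1 / 2) ^ n / 2 = l * (1 / 2) ^ (n + 1) := by ring
      rwa [e1, e2] at h1
  refine ⟨1 + D * l ^ κ * (1 - ρ)⁻¹, ?_, fun t ht => ?_⟩
  · have : 0 < (1 - ρ)⁻¹ := inv_pos.2 (sub_pos.2 hρ1)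
    positivity
  · have hsum : ∀ n, τ n < t := fun n => by
      refine lt_of_lt_of_le ?_ ht
      have h1 : ∑ i ∈ Finset.range n, ρ ^ i < (1 - ρ)⁻¹ := by
        rw [geom_sum_eq hρ1.ne, ← neg_div_neg_eq, neg_sub, neg_sub, ← one_div]
        exact div_lt_div_of_pos_right (by linarith [pow_pos hρ0 n]) (sub_pos.2 hρ1)
      have h2 : 0 < D * l ^ κ := by positivity
      simp only [τ]
      linarith [mul_lt_mul_of_pos_left h1 h2]
    have hle : ∀ n : ℕ, V t ≤ ENNReal.ofReal (l * (1 / 2) ^ n) := fun n =>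
      (hV (τ n) t (by linarith [hτ1 n]) (hsum n)).trans (hτ n)
    have hlim : Tendsto (fun n : ℕ => ENNReal.ofReal (l * (1 / 2) ^ n)) atTop (𝓝 0) := by
      have := (tendsto_pow_atTop_nhds_zero_of_lt_one (r := (1 / 2 : ℝ)) (by norm_num)
        (by norm_num)).const_mul l
      simpa using ENNReal.tendsto_ofReal this
    exact le_antisymm (ge_of_tendsto' hlim hle) zero_le

variable {N : ℕ} {σ : ℝ} {φ : ℝ → ℝ} {u g : ℝ → EuclideanSpace ℝ (Fin N) → ℝ}
  {u₀ : EuclideanSpace ℝ (Fin N) → ℝ}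
  {J : EuclideanSpace ℝ (Fin N) → EuclideanSpace ℝ (Fin N) → ℝ} {q : ℝ}

/-- The `p`-th power of the `L^p` norm of a nonnegative function. -/
noncomputable def powerMass (p : ℝ) (f : EuclideanSpace ℝ (Fin N) → ℝ) : ℝ≥0∞ :=
  ∫⁻ x, ENNReal.ofReal (f x ^ p)

theorem ofReal_integral_entropy_le {f : EuclideanSpace ℝ (Fin N) → ℝ} (hf : Integrable f)
    (hf0 : ∀ᵐ x, 0 ≤ f x) (hq : 0 < q) {K : ℝ} (hK : 1 ≤ K) {B L ε : ℝ}
    (hθ : IsTruncation φ (truncPow q K) B L ε) :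
    ENNReal.ofReal (∫ x, entropy (truncPow q K) (f x)) ≤
      ENNReal.ofReal (1 / (q + 1)) * powerMass (q + 1) f := by
  rw [ofReal_integral_eq_lintegral_ofReal (hθ.integrable_entropy hf)
    (by filter_upwards [hf0] with x hx using hθ.entropy_nonneg hx), powerMass,
    ← lintegral_const_mul' _ _ ENNReal.ofReal_ne_top]
  refine lintegral_mono_ae ?_
  filter_upwards [hf0] with x hx
  rw [← ENNReal.ofReal_mul (by positivity)]
  refine ENNReal.ofReal_le_ofReal ((entropy_truncPow_le hq hK hx).trans_eq ?_)
  ring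

/-- Fatou's lemma, as the truncated entropies converge pointwise to `s^(q+1)/(q+1)`. -/
theorem powerMass_le_of_forall_entropy_le {f : EuclideanSpace ℝ (Fin N) → ℝ} (hf : Integrable f)
    (hf0 : ∀ᵐ x, 0 ≤ f x) (hq : 0 < q)
    (hθ : ∀ n : ℕ, ∃ B L ε, IsTruncation φ (truncPow q (n + 1 : ℝ)) B L ε) {C : ℝ≥0∞}
    (hC : ∀ n : ℕ, ENNReal.ofReal (∫ x, entropy (truncPow q (n + 1 : ℝ)) (f x)) ≤ C) :
    ENNReal.ofReal (1 / (q + 1)) * powerMass (q + 1) f ≤ C := by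
  rw [powerMass, ← lintegral_const_mul' _ _ ENNReal.ofReal_ne_top]
  refine lintegral_le_of_tendsto_of_forall_le
    (f := fun n x => ENNReal.ofReal (entropy (truncPow q (n + 1 : ℝ)) (f x)))
    (fun n => ?_) ?_ (fun n => ?_)
  · obtain ⟨B, L, ε, h⟩ := hθ n
    exact (h.integrable_entropy hf).aestronglyMeasurable.aemeasurable.ennreal_ofReal
  · filter_upwards [hf0] with x hx
    rw [← ENNReal.ofReal_mul (by positivity)]
    have := ENNReal.tendsto_ofReal (tendsto_entropy_truncPow hq hx)
    rwa [div_eq_inv_mul, ← one_div] at this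
  · obtain ⟨B, L, ε, h⟩ := hθ n
    refine le_trans (le_of_eq ?_) (hC n)
    rw [ofReal_integral_eq_lintegral_ofReal (h.integrable_entropy hf)
      (by filter_upwards [hf0] with x hx using h.entropy_nonneg hx)]

theorem powerMass_antitone (hN : N ≠ 0) (hσ : σ ∈ Ioo (0 : ℝ) 2)
    (hg : IsRepresentative φ u g) (hu : IsWeakSolution σ J φ u₀ u)
    (hu_nonneg : ∀ t : ℝ, 0 ≤ t → ∀ᵐ x ∂volume, 0 ≤ u t x)
    (hJm : AEStronglyMeasurable (kernelRatio σ J) (volume.prod volume)) {Λ : ℝ}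
    (hJb : ∀ p, 0 ≤ kernelRatio σ J p ∧ kernelRatio σ J p ≤ Λ) (hq : 0 < q)
    (hθ : ∀ n : ℕ, ∃ B L ε, IsTruncation φ (truncPow q (n + 1 : ℝ)) B L ε)
    {s t : ℝ} (hs : 0 ≤ s) (hst : s < t) :
    powerMass (q + 1) (u t) ≤ powerMass (q + 1) (u s) := by
  have hui : ∀ r, 0 ≤ r → Integrable (u r) := fun r hr =>
    memLp_one_iff_integrable.1 (hu.memLp_one r hr)
  have h := powerMass_le_of_forall_entropy_le (hui t (hs.trans hst.le))
    (hu_nonneg t (hs.trans hst.le)) hq hθ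
    (C := ENNReal.ofReal (1 / (q + 1)) * powerMass (q + 1) (u s)) fun n => by
      obtain ⟨B, L, ε, h⟩ := hθ n
      exact (ENNReal.ofReal_le_ofReal
        (entropy_antitone hN hσ hg hu hu_nonneg hJm hJb h hs hst)).trans
        (ofReal_integral_entropy_le (hui s hs) (hu_nonneg s hs) hq (by simp) h)
  have hpos : ENNReal.ofReal (1 / (q + 1)) ≠ 0 := by
    simp only [ne_eq, ENNReal.ofReal_eq_zero, not_le]; positivity
  exact (ENNReal.mul_le_mul_iff_right hpos ENNReal.ofReal_ne_top).1 h

theorem powerMass_congr_ae {p : ℝ} {f f' : EuclideanSpace ℝ (Fin N) → ℝ}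
    (h : f =ᵐ[volume] f') : powerMass p f = powerMass p f' :=
  lintegral_congr_ae (by filter_upwards [h] with x hx; rw [hx])

/-- On `(s, t]` the mass stays below `lam`, so the Sobolev inequality applies at almost every time
with the same constant. Inserting it in the entropy inequality and letting the truncation level tend
to infinity bounds the time integral of the mass, which by monotonicity is at least `t - s` times
its final value. -/
theorem mul_powerMass_le (hN : N ≠ 0) (hσ : σ ∈ Ioo (0 : ℝ) 2)
    (hg : IsRepresentative φ u g) (hu : IsWeakSolution σ J φ u₀ u)
    (hu_nonneg : ∀ t : ℝ, 0 ≤ t → ∀ᵐ x ∂volume, 0 ≤ u t x)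
    (hJm : AEStronglyMeasurable (kernelRatio σ J) (volume.prod volume)) {Λ : ℝ}
    (hJb : ∀ p, 0 ≤ kernelRatio σ J p ∧ kernelRatio σ J p ≤ Λ) (hq : 0 < q)
    (hθ : ∀ n : ℕ, ∃ B L ε, IsTruncation φ (truncPow q (n + 1 : ℝ)) B L ε) {C : ℝ}
    (hdis : ∀ (f : EuclideanSpace ℝ (Fin N) → ℝ), Measurable f → (∀ x, 0 ≤ f x) →
      ∀ lam : ℝ, 0 < lam → ∫⁻ x, ENNReal.ofReal (f x ^ (q + 1)) ≤ ENNReal.ofReal lam →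
      ∀ K : ℝ, 1 ≤ K → ENNReal.ofReal (C * lam ^ (-(σ / N))) *
        ∫⁻ x in {x | 2 / K ≤ f x ∧ f x ≤ K}, ENNReal.ofReal (f x ^ (q + 1)) ≤
          dissipation σ J φ (truncPow q K) f)
    {s t lam : ℝ} (hs : 0 < s) (hst : s < t) (hlam : 0 < lam)
    (hV : powerMass (q + 1) (u s) ≤ ENNReal.ofReal lam) :
    ENNReal.ofReal (1 / 2) * (ENNReal.ofReal (C * lam ^ (-(σ / N))) *
      (powerMass (q + 1) (u t) * ENNReal.ofReal (t - s))) ≤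
        ENNReal.ofReal (1 / (q + 1)) * ENNReal.ofReal lam := by
  have hanti := fun {s t : ℝ} (hs : 0 ≤ s) (hst : s < t) =>
    powerMass_antitone hN hσ hg hu hu_nonneg hJm hJb hq hθ hs hst
  have hsub : Ioc s t ⊆ Ioi (0 : ℝ) := fun x hx => hs.trans hx.1
  let S : ℕ → Set (ℝ × EuclideanSpace ℝ (Fin N)) := fun n =>
    {z | 2 / (n + 1 : ℝ) ≤ g z.1 z.2 ∧ g z.1 z.2 ≤ n + 1}
  have hgm : Measurable fun z : ℝ × EuclideanSpace ℝ (Fin N) => g z.1 z.2 := hg.measurable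
  have hSm : ∀ n, MeasurableSet (S n) := fun n =>
    (measurableSet_le measurable_const hgm).inter (measurableSet_le hgm measurable_const)
  let F : ℕ → ℝ × EuclideanSpace ℝ (Fin N) → ℝ≥0∞ := fun n =>
    (S n).indicator fun z => ENNReal.ofReal (g z.1 z.2 ^ (q + 1))
  have hFm : ∀ n, Measurable (F n) := fun n =>
    ((hgm.pow_const _).ennreal_ofReal).indicator (hSm n)
  have hGm : Measurable fun z : ℝ × EuclideanSpace ℝ (Fin N) =>
    ENNReal.ofReal (g z.1 z.2 ^ (q + 1)) := (hgm.pow_const _).ennreal_ofReal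
  set κ : ℝ≥0∞ := ENNReal.ofReal (1 / 2) * ENNReal.ofReal (C * lam ^ (-(σ / N))) with hκ
  have hκt : κ ≠ ⊤ := ENNReal.mul_ne_top ENNReal.ofReal_ne_top ENNReal.ofReal_ne_top
  have hbound : ∀ n, ∫⁻ z, κ * F n z ∂((volume.restrict (Ioc s t)).prod volume) ≤
      ENNReal.ofReal (1 / (q + 1)) * ENNReal.ofReal lam := by
    intro n
    obtain ⟨B, L, ε, h⟩ := hθ n
    have h1 := entropy_add_dissipation_le hN hσ hg hu hu_nonneg hJm hJb h hs hst
    have h2 := le_add_self.trans (h1.trans (ofReal_integral_entropy_le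
      (memLp_one_iff_integrable.1 (hu.memLp_one s hs.le)) (hu_nonneg s hs.le) hq (by simp) h))
    refine le_trans ?_ (h2.trans (mul_le_mul_right hV _))
    rw [lintegral_const_mul _ (hFm n), hκ, mul_assoc]
    refine mul_le_mul_right ?_ _
    rw [lintegral_prod _ (hFm n).aemeasurable, ← lintegral_const_mul' _ _ ENNReal.ofReal_ne_top]
    refine lintegral_mono_ae ?_
    filter_upwards [ae_restrict_of_ae_restrict_of_subset hsub hg.ae_eq,
      ae_restrict_mem measurableSet_Ioc] with r hr hr'
    have hVr : powerMass (q + 1) (g r) ≤ ENNReal.ofReal lam := by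
      rw [powerMass_congr_ae hr]
      exact (hanti hs.le hr'.1).trans hV
    refine le_trans (le_of_eq ?_) (hdis (g r) (hg.measurable_slice r) (hg.nonneg r) lam hlam hVr
      (n + 1 : ℝ) (by simp))
    congr 1
    rw [← lintegral_indicator]
    · rfl
    · exact (measurableSet_le measurable_const (hg.measurable_slice r)).inter
        (measurableSet_le (hg.measurable_slice r) measurable_const)
  -- For fixed `z` the truncated integrand is eventually the full one: where `g > 0` the level sets
  -- `S n` eventually contain `z`, and where `g = 0` both sides vanish.
  have hlim := lintegral_le_of_tendsto_of_forall_le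
    (F := fun z : ℝ × EuclideanSpace ℝ (Fin N) => κ * ENNReal.ofReal (g z.1 z.2 ^ (q + 1)))
    (f := fun n z => κ * F n z) (fun n => ((hFm n).const_mul κ).aemeasurable)
    (Eventually.of_forall fun z => ENNReal.Tendsto.const_mul (tendsto_const_nhds.congr' ?_)
      (Or.inr hκt)) hbound
  · refine le_trans ?_ hlim
    rw [lintegral_const_mul _ hGm, ← mul_assoc, ← hκ, lintegral_prod _ hGm.aemeasurable]
    refine mul_le_mul_right ?_ _
    rw [← Real.volume_Ioc, ← setLIntegral_const]
    refine lintegral_mono_ae ?_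
    filter_upwards [ae_restrict_of_ae_restrict_of_subset hsub hg.ae_eq,
      ae_restrict_mem measurableSet_Ioc] with r hr hr'
    change powerMass (q + 1) (u t) ≤ powerMass (q + 1) (g r)
    rw [powerMass_congr_ae hr]
    rcases hr'.2.eq_or_lt with h | h
    · rw [h]
    · exact hanti (hsub hr').le h
  · rcases (hg.nonneg z.1 z.2).eq_or_lt with h0 | h0
    · refine Eventually.of_forall fun n => ?_
      rw [← h0, Real.zero_rpow (by linarith), ENNReal.ofReal_zero]
      by_cases hz : z ∈ S n
      · simp [F, indicator_of_mem hz, ← h0, Real.zero_rpow (by linarith : q + 1 ≠ 0)]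
      · simp [F, indicator_of_notMem hz]
    · have h1 := (tendsto_one_div_add_atTop_nhds_zero_nat (𝕜 := ℝ)).const_mul 2
      rw [mul_zero] at h1
      filter_upwards [h1.eventually (gt_mem_nhds h0),
        eventually_ge_atTop ⌈g z.1 z.2⌉₊] with n hn hn'
      have : g z.1 z.2 ≤ n := (Nat.le_ceil _).trans (by exact_mod_cast hn')
      rw [mul_one_div] at hn
      have hz : z ∈ S n := ⟨hn.le, by linarith⟩
      simp only [F, indicator_of_mem hz]

/-- Interpolation: `f^p ≤ M^(p-1) f` with `M` the essential supremum. -/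
theorem powerMass_lt_top {p : ℝ} (hp : 1 ≤ p) {f : EuclideanSpace ℝ (Fin N) → ℝ}
    (h1 : MemLp f 1 volume) (h2 : MemLp f ⊤ volume) (hf0 : ∀ᵐ x, 0 ≤ f x) :
    powerMass p f < ⊤ := by
  rw [MemLp, eLpNorm_exponent_top] at h2
  set M : ℝ := (eLpNormEssSup f volume).toReal with hM
  have hfM : ∀ᵐ x, f x ≤ M := by
    filter_upwards [ae_le_eLpNormEssSup (f := f) (μ := volume)] with x hx
    rw [← ENNReal.ofReal_toReal h2.2.ne, Real.enorm_eq_ofReal_abs,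
      ENNReal.ofReal_le_ofReal_iff ENNReal.toReal_nonneg] at hx
    exact (le_abs_self _).trans hx
  have hi := (memLp_one_iff_integrable.1 h1).const_mul (M ^ (p - 1))
  refine lt_of_le_of_lt (lintegral_mono_ae ?_) hi.lintegral_lt_top
  filter_upwards [hf0, hfM] with x hx hxM
  refine ENNReal.ofReal_le_ofReal ?_
  rcases hx.eq_or_lt with h | h
  · rw [← h, Real.zero_rpow (by linarith), mul_zero]
  · calc f x ^ p = f x ^ (p - 1) * f x := by
          rw [← Real.rpow_add_one h.ne']; congr 1; ring
      _ ≤ M ^ (p - 1) * f x :=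
          mul_le_mul_of_nonneg_right (Real.rpow_le_rpow hx hxM (by linarith)) hx

theorem ae_eq_zero_of_powerMass_eq_zero {p : ℝ} (hp : p ≠ 0) {f : EuclideanSpace ℝ (Fin N) → ℝ}
    (hf : AEMeasurable f volume) (hf0 : ∀ᵐ x, 0 ≤ f x) (h : powerMass p f = 0) :
    ∀ᵐ x, f x = 0 := by
  rw [powerMass, lintegral_eq_zero_iff' (hf.pow_const p).ennreal_ofReal] at h
  filter_upwards [h, hf0] with x hx hx0
  have h1 : f x ^ p ≤ 0 := ENNReal.ofReal_eq_zero.1 hx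
  exact (Real.rpow_eq_zero hx0 hp).1 (le_antisymm h1 (Real.rpow_nonneg hx0 p))

end

end FastDiffusion

/-! ### Choice of the exponent and conclusion -/

theorem theoremA2 (N : ℕ) (σ : ℝ) (hσ : σ ∈ Set.Ioo (0 : ℝ) 2)
    (J : EuclideanSpace ℝ (Fin N) → EuclideanSpace ℝ (Fin N) → ℝ)
    (hJ : FastDiffusion.IsStableLikeKernel σ J)
    (φ : ℝ → ℝ) (hφ : FastDiffusion.IsFastDiffusionNonlinearity φ)
    (m : ℝ) (hm_pos : 0 < m) (hm_lt : m < FastDiffusion.criticalExponent N σ)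
    (c : ℝ) (hc : 0 < c) (hφ_deriv : ∀ s : ℝ, 0 < s → c * s ^ (m - 1) ≤ deriv φ s)
    (u₀ : EuclideanSpace ℝ (Fin N) → ℝ)
    (hu₀_one : MemLp u₀ 1 volume) (hu₀_top : MemLp u₀ ⊤ volume)
    (u : ℝ → EuclideanSpace ℝ (Fin N) → ℝ)
    (hu : FastDiffusion.IsWeakSolution σ J φ u₀ u)
    (hu_nonneg : ∀ t : ℝ, 0 ≤ t → ∀ᵐ x ∂volume, 0 ≤ u t x) :
    ∃ T : ℝ, 0 < T ∧ ∀ t : ℝ, T ≤ t → ∀ᵐ x ∂volume, u t x = 0 := by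
  -- For `N = 0` the critical exponent is `0` by the convention for division by zero, contradicting
  -- `0 < m`.
  have hN : N ≠ 0 := by
    rintro rfl
    simp [FastDiffusion.criticalExponent] at hm_lt
    linarith
  have hN0 : (0 : ℝ) < N := by exact_mod_cast Nat.pos_of_ne_zero hN
  have hσN : m * N < N - σ := by
    rw [FastDiffusion.criticalExponent, lt_div_iff₀ hN0] at hm_lt
    rcases le_total ((N : ℝ) - σ) 0 with h | h
    · rw [max_eq_right h] at hm_lt
      exact absurd hm_lt (not_lt.2 (by positivity))
    · rwa [max_eq_left h] at hm_lt
  have hσ0 : 0 < σ := hσ.1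
  have hm1 : m < 1 := by
    by_contra h
    nlinarith [not_lt.1 h]
  -- The exponent that balances the powers in the Sobolev inequality. Its positivity is equivalent
  -- to `m * N < N - σ`.
  set q : ℝ := N * (1 - m) / σ - 1 with hq
  have hq0 : 0 < q := by
    rw [hq, sub_pos, lt_div_iff₀ hσ0]
    linarith
  have hqm : (q + 1) * (σ / N) = 1 - m := by
    rw [hq]; field_simp; ring
  obtain ⟨g, hg⟩ := FastDiffusion.exists_isRepresentative hφ hu.aestronglyMeasurable hu_nonneg
  have hJm := hJ.aestronglyMeasurable_ratio
  obtain ⟨Λ, hΛ, hJb, hJl⟩ := hJ.exists_ratio_bounds (by positivity)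
  have hθ : ∀ n : ℕ, ∃ B L ε,
      FastDiffusion.IsTruncation φ (FastDiffusion.truncPow q (n + 1 : ℝ)) B L ε := fun n =>
    FastDiffusion.exists_isTruncation_truncPow hφ hm1 hc hφ_deriv hq0 (by simp)
  obtain ⟨C, hC, hdis⟩ := FastDiffusion.exists_mul_lintegral_le_dissipation hN hσ0 hΛ
    (fun p => (hJb p).1) hJl hφ hm1 hc hφ_deriv hq0 hqm
  have hκ : 0 < σ / N := by positivity
  -- With `t - s = D lam^(σ/N)` the decay estimate reads `(C D / 2) V(t) ≤ lam / (q + 1)`; the value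
  -- of `D` is the one that makes this `V(t) ≤ lam / 2`.
  obtain ⟨T, hT, hTz⟩ := FastDiffusion.exists_forall_eq_zero_of_halving
    (V := fun t => FastDiffusion.powerMass (q + 1) (u t)) (D := 4 / (C * (q + 1))) (κ := σ / N)
    (fun s t hs hst =>
      FastDiffusion.powerMass_antitone hN hσ hg hu hu_nonneg hJm hJb hq0 hθ hs hst)
    (by
      rw [FastDiffusion.powerMass_congr_ae hu.initial]
      refine FastDiffusion.powerMass_lt_top (by linarith) hu₀_one hu₀_top ?_
      filter_upwards [hu.initial, hu_nonneg 0 le_rfl] with x hx hx0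
      rwa [← hx])
    (by positivity) hκ
    (fun s lam hs hlam hV => by
      have hτ : 0 < 4 / (C * (q + 1)) * lam ^ (σ / N) := by positivity
      have h := FastDiffusion.mul_powerMass_le hN hσ hg hu hu_nonneg hJm hJb hq0 hθ hdis hs
        (lt_add_of_pos_right s hτ) hlam hV
      rw [add_sub_cancel_left, mul_comm (FastDiffusion.powerMass _ _), ← mul_assoc, ← mul_assoc,
        ← ENNReal.ofReal_mul (by norm_num), ← ENNReal.ofReal_mul (by positivity),
        ← ENNReal.ofReal_mul (by positivity)] at h
      have e1 : 1 / 2 * (C * lam ^ (-(σ / N))) * (4 / (C * (q + 1)) * lam ^ (σ / N)) =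
          2 / (q + 1) := by
        rw [Real.rpow_neg hlam.le]
        field_simp
        norm_num
      have e2 : 1 / (q + 1) * lam = 2 / (q + 1) * (lam / 2) := by ring
      rw [e1, e2, ENNReal.ofReal_mul (by positivity)] at h
      have hpos : ENNReal.ofReal (2 / (q + 1)) ≠ 0 := by
        simp only [ne_eq, ENNReal.ofReal_eq_zero, not_le]; positivity
      exact (ENNReal.mul_le_mul_iff_right hpos ENNReal.ofReal_ne_top).1 h)
  refine ⟨T, hT, fun t ht => ?_⟩
  have ht0 : 0 ≤ t := hT.le.trans ht
  exact FastDiffusion.ae_eq_zero_of_powerMass_eq_zero (by linarith)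
    (hu.memLp_one t ht0).1.aemeasurable (hu_nonneg t ht0) (hTz t ht)
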